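/- **Setting.** Let $R$ be a finite commutative chain ring, i.e. a finite commutative local ring whose maximal ideal $M=\langle a\rangle$ is principal. Let $t$ be the nilpotency index of $a$ and $q=|R/M|$. Every $c\in R$ is $c=a^i u$ with $u$ a unit and a unique $0\le i\le t$; put $\|c\|=i$ (so $\|0\|=t$). Let $t_j(X_j)\in R[X_j]$ ($1\le j\le r$) be monic of degree $n_j$, $n=\prod_j n_j$, and $\mathcal A=R[X_1,\dots,X_r]/\langle t_1(X_1),\dots,t_r(X_r)\rangle$. Each element of $\mathcal A$ is identified with its unique representative all of whose exponents $\mathbf i$ satisfy $0\le i_j<n_j$ for all $j$. Fix a monomial order $\preceq$ on $\mathbb N_0^r$. For $f=\sum f_{\mathbf i}\mathbf X^{\mathbf i}\in R[X_1,\dots,X_r]$ let $\mathfrak S(f)$ be its support, $\|f\|=\min_{\mathbf i}\|f_{\mathbf i}\|$, $\mathrm{ldg}(f)$ (for $f\neq0$) the $\preceq$-largest $\mathbf i$ with $\|f_{\mathbf i}\|=\|f\|$, $\mathrm{Lt}(f)=\mathbf X^{\mathrm{ldg}(f)}$, and $\mathrm{Lc}(f)$ the coefficient of $\mathrm{Lt}(f)$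 in $f$. *Normal forms.* For polynomials $f,g$, an $L$-reduction step of $f$ mod $g$ replaces $f$ by $f-c\mathbf X^{\mathbf i}g$, where $c\in R$ and $c\,\mathrm{Lc}(g)\ne 0$ equals the coefficient of $\mathbf X^{\mathbf i}\mathrm{Lt}(g)$ in $f$. A polynomial is normal mod a set $\chi$ if no step mod an element of $\chi$ applies to it; a normal form of $f$ mod $\chi$ is a polynomial normal mod $\chi$ obtained from $f$ by finitely many (possibly zero) steps mod elements of $\chi$. *Krull systems.* A Ferrers diagram is a finite subset $\mathcal F\subset\mathbb N_0^r$ closed downwards for the componentwise order; $\mathcal{KF}$ is the set of minimal elements of $\mathbb N_0^r\setminus\mathcal F$. A Krull system of $\mathcal F$-monic polynomials is a set $\chi=\{g^{\mathbf s}\mid \mathbf s\in\mathcal{KF}\}\subset R[X_1,\dots,X_r]$ with $g^{\mathbf s}=\mathbf X^{\mathbf s}-\sum_{\mathbf u\in\mathcal F}g^{\mathbf s}_{\mathbf u}\mathbf X^{\mathbf u}$, such that reduction mod $M$ is injective on $\chi$ and its image $\overline\chi$ is a reduced Gröbner basis (for $\preceq$) of the ideal $\langle\overline\chi\rangle$ of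 $\mathbb F_q[X_1,\dots,X_r]$. *Codes.* For an $\mathcal A$-submodule $C$ of $\mathcal A^l$ let $\pi_i$ be the $i$-th projection and let $C_i$ be the submodule of the $c\in C$ with $c_1=\dots=c_{i-1}=0$. **Theorem.** Let $C\ne 0$ be an $\mathcal A$-submodule of $\mathcal A^l$. Then there are a number $1\le k\le l$; positions $1\le i_1<\dots<i_k\le l$, which are exactly the $i$ with $\pi_i(C_i)\neq 0$; numbers $0\le x_1,\dots,x_k\le t-1$; and for each $1\le j\le k$ a strictly decreasing chain of Ferrers diagrams $\mathcal F^j_0\supset\dots\supset\mathcal F^j_{x_j}$ contained in $\prod_{j'=1}^r\{0,\dots,n_{j'}-1\}$, integers $0=b^j_0<b^j_1<\dots<b^j_{x_j}<b^j_{x_j+1}=t$, and Krull systems $\chi^j_m$ of $\mathcal F^j_m$-monic polynomials ($0\le m\le x_j$), such that for every $1\le j\le k$: 1. if $f\in\pi_{i_j}(C_{i_j})$, $0\le m\le x_j$ and $\mathfrak S(f)\subseteq\mathcal F^j_m$, then $\|f\|\ge b^j_{m+1}$; 2. $a^{b^j_m}\chi^j_m\subseteq\pi_{i_j}(C_{i_j})$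 (modulo $\langle t_1,\dots,t_r\rangle$) for all $0\le m\le x_j$; 3. the set $\chi^j=\chi^j_0\cup a^{b^j_1}\chi^j_1\cup\dots\cup a^{b^j_{x_j}}\chi^j_{x_j}$ is a canonical generating system of $\pi_{i_j}(C_{i_j})$, i.e. (a) the ideal $\pi_{i_j}(C_{i_j})$ of $\mathcal A$ is generated by $\chi^j$; (b) for every $f\in\mathcal A$ there are sequences with $h_0=f$ and $h_{m+1}$ a normal form of $h_m$ mod $\chi^j_m$ ($0\le m\le x_j$), and for every such sequence: $f\in\pi_{i_j}(C_{i_j})$ if and only if $\|h_m\|\ge b^j_m$ for all $0\le m\le x_j$ and $h_{x_j+1}=0$; (c) with $|\mathcal F^j_{-1}|:=n$, $\;|\pi_{i_j}(C_{i_j})|=q^{\sum_{m=0}^{x_j}(t-b^j_m)(|\mathcal F^j_{m-1}|-|\mathcal F^j_m|)}$. Moreover $|C|=q^{\sum_{j=1}^k\sum_{m=0}^{x_j}(t-b^j_m)(|\mathcal F^j_{m-1}|-|\mathcal F^j_m|)}$, and for all $1\le j\le k$, $0\le m\le x_j$, $g\in\chi^j_m$ there are $h^{j,m,g}_z\in\mathcal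 A$ ($i_j<z\le l$) such that $h^{j,m,g}_{i_{j'}}$ is normal mod $\chi^{j'}$ for every $j<j'\le k$, and the matrix whose rows are $$\bigl(0,\dots,0,\;a^{b^j_m}g,\;h^{j,m,g}_{i_j+1},\dots,h^{j,m,g}_l\bigr)\qquad(a^{b^j_m}g\text{ in position } i_j)$$ for all such $j,m,g$ is a generator matrix of $C$, i.e. its rows generate $C$ as an $\mathcal A$-module. -/

import Mathlib

open scoped Polynomial

noncomputable section

namespace ChainCode

/-! ### The affine algebra and reduced representatives -/

section AffineAlgebra

variable {R : Type*} [CommRing R] {r : ℕ}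

/-- The ideal `⟨t₁(X₁), …, t_r(X_r)⟩` of `R[X₁, …, X_r]`. -/
def definingIdeal (T : Fin r → R[X]) : Ideal (MvPolynomial (Fin r) R) :=
  Ideal.span (Set.range fun i => Polynomial.aeval (MvPolynomial.X i : MvPolynomial (Fin r) R) (T i))

/-- The affine algebra `R[X₁, …, X_r] / ⟨t₁(X₁), …, t_r(X_r)⟩`. -/
abbrev AffineAlgebra (T : Fin r → R[X]) : Type _ :=
  MvPolynomial (Fin r) R ⧸ definingIdeal T

/-- The class of a polynomial in the affine algebra. -/
abbrev toAlg (T : Fin r → R[X]) : MvPolynomial (Fin r) R →+* AffineAlgebra T :=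
  Ideal.Quotient.mk (definingIdeal T)

/-- All exponents of `p` lie in the box `∏ {0, …, n_j - 1}`, where `n_j = deg t_j`. -/
def IsReducedPoly (T : Fin r → R[X]) (p : MvPolynomial (Fin r) R) : Prop :=
  ∀ e ∈ p.support, ∀ j, e j < (T j).natDegree

theorem coeff_aeval_X (i : Fin r) (p : R[X]) (e : Fin r →₀ ℕ) :
    (Polynomial.aeval (MvPolynomial.X i : MvPolynomial (Fin r) R) p).coeff e =
      ∑ k ∈ Finset.range (p.natDegree + 1),
        if Finsupp.single i k = e then p.coeff k else 0 := by
  rw [Polynomial.aeval_eq_sum_range, MvPolynomial.coeff_sum]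
  refine Finset.sum_congr rfl fun k _ => ?_
  rw [MvPolynomial.coeff_smul, MvPolynomial.coeff_X_pow]
  split_ifs <;> simp

/-- Every element of the affine algebra has a reduced representative. -/
theorem exists_reduced (T : Fin r → R[X]) (hT : ∀ j, (T j).Monic) (f : AffineAlgebra T) :
    ∃ p : MvPolynomial (Fin r) R, IsReducedPoly T p ∧ toAlg T p = f := by
  obtain ⟨f, rfl⟩ := Ideal.Quotient.mk_surjective f
  rcases subsingleton_or_nontrivial R with hR | hR
  · exact ⟨0, by simp [IsReducedPoly], by rw [Subsingleton.elim f 0]⟩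
  let m : MonomialOrder (Fin r) := MonomialOrder.lex
  let B : Fin r → MvPolynomial (Fin r) R := fun i => Polynomial.aeval (MvPolynomial.X i) (T i)
  have hc : ∀ i, (B i).coeff (Finsupp.single i (T i).natDegree) = 1 := by
    intro i
    rw [coeff_aeval_X, Finset.sum_eq_single (T i).natDegree]
    · rw [if_pos rfl]
      exact hT i
    · intro k _ hk
      rw [if_neg]
      intro h
      exact hk (Finsupp.single_injective i h)
    · simp
  have hdeg : ∀ i, m.degree (B i) = Finsupp.single i (T i).natDegree := by
    intro i
    apply m.toSyn.injective
    apply le_antisymm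
    · rw [m.degree_le_iff]
      intro e he
      rw [MvPolynomial.mem_support_iff, coeff_aeval_X] at he
      obtain ⟨k, hk, hke⟩ := Finset.exists_ne_zero_of_sum_ne_zero he
      have hek : Finsupp.single i k = e := by
        by_contra h
        simp [h] at hke
      rw [← hek]
      apply m.toSyn_monotone
      exact Finsupp.single_mono (Nat.lt_succ_iff.mp (Finset.mem_range.mp hk))
    · apply m.le_degree
      rw [MvPolynomial.mem_support_iff, hc]
      exact one_ne_zero
  have hlc : ∀ i, IsUnit (m.leadingCoeff (B i)) := by
    intro i
    rw [MonomialOrder.leadingCoeff, hdeg, hc]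
    exact isUnit_one
  obtain ⟨g, p, hf, -, hp⟩ := m.div hlc f
  refine ⟨p, ?_, ?_⟩
  · intro e he j
    have := hp e he j
    rw [hdeg, Finsupp.single_le_iff] at this
    exact not_le.mp this
  · rw [eq_comm, Ideal.Quotient.eq, hf, add_sub_cancel_right, Finsupp.linearCombination_apply]
    refine Submodule.sum_mem _ fun i _ => ?_
    exact Ideal.mul_mem_left _ _ (Ideal.subset_span ⟨i, rfl⟩)

/-- The reduced polynomial with which an element of the affine algebra is identified. -/
def rep (T : Fin r → R[X]) (hT : ∀ j, (T j).Monic) (f : AffineAlgebra T) :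
    MvPolynomial (Fin r) R :=
  (exists_reduced T hT f).choose

end AffineAlgebra

/-! ### Norms and `L`-reduction -/

section Reduction

variable {R : Type*} [CommRing R] {r : ℕ}

open Classical in
/-- The norm of an element of a chain ring whose maximal ideal is generated by `a`: the exponent
`i` in `c = a ^ i * unit`, `0 ≤ i ≤ t`, where `t` is the nilpotency index of `a`; `‖0‖ = t`. -/
def chainNorm (a c : R) : ℕ :=
  Nat.findGreatest (fun i => a ^ i ∣ c) (nilpotencyClass a)

/-- The norm of a polynomial: the minimum of the norms of its coefficients; `‖0‖ = t`. -/
def polyNorm (a : R) (f : MvPolynomial (Fin r) R) : ℕ :=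
  ⨅ e : Fin r →₀ ℕ, chainNorm a (f.coeff e)

/-- `e` is the leading degree of `f`: the largest exponent whose coefficient has norm `‖f‖`. -/
def IsLeadingDegree (ord : MonomialOrder (Fin r)) (a : R) (f : MvPolynomial (Fin r) R)
    (e : Fin r →₀ ℕ) : Prop :=
  chainNorm a (f.coeff e) = polyNorm a f ∧
    ∀ e', chainNorm a (f.coeff e') = polyNorm a f → ord.toSyn e' ≤ ord.toSyn e

/-- `f` is `L`-reduced to `h` mod `g` in one step: `h = f - c X^i g`, where
`0 ≠ c Lc(g) = Cf(f, X^i Lt(g))`. -/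
def LStep (ord : MonomialOrder (Fin r)) (a : R) (g f h : MvPolynomial (Fin r) R) : Prop :=
  ∃ (e i : Fin r →₀ ℕ) (c : R), IsLeadingDegree ord a g e ∧
    c * g.coeff e ≠ 0 ∧ c * g.coeff e = f.coeff (i + e) ∧
    h = f - MvPolynomial.monomial i c * g

/-- `f` is `L`-reduced to `h` mod the set `χ`, in finitely many (possibly zero) steps. -/
def LReduces (ord : MonomialOrder (Fin r)) (a : R) (χ : Set (MvPolynomial (Fin r) R)) :
    MvPolynomial (Fin r) R → MvPolynomial (Fin r) R → Prop :=
  Relation.ReflTransGen fun f h => ∃ g ∈ χ, LStep ord a g f h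

/-- `f` is normal mod `χ`: it cannot be `L`-reduced mod `χ`. -/
def IsNormal (ord : MonomialOrder (Fin r)) (a : R) (χ : Set (MvPolynomial (Fin r) R))
    (f : MvPolynomial (Fin r) R) : Prop :=
  ¬ ∃ h, ∃ g ∈ χ, LStep ord a g f h

/-- The set `NF(f, χ)` of normal forms of `f` mod `χ`. -/
def NF (ord : MonomialOrder (Fin r)) (a : R) (χ : Set (MvPolynomial (Fin r) R))
    (f : MvPolynomial (Fin r) R) : Set (MvPolynomial (Fin r) R) :=
  {h | IsNormal ord a χ h ∧ LReduces ord a χ f h}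

/-- `h 0 = f` and `h (m + 1)` is a normal form of `h m` mod `χ m` for `0 ≤ m ≤ x`. -/
def IsNFSequence (ord : MonomialOrder (Fin r)) (a : R) (x : ℕ)
    (χ : ℕ → Finset (MvPolynomial (Fin r) R)) (f : MvPolynomial (Fin r) R)
    (h : ℕ → MvPolynomial (Fin r) R) : Prop :=
  h 0 = f ∧ ∀ m ≤ x, h (m + 1) ∈ NF ord a (χ m : Set (MvPolynomial (Fin r) R)) (h m)

end Reduction

/-! ### Ferrers diagrams and Krull systems -/

section Krull

variable {r : ℕ}

/-- A Ferrers diagram: a finite subset of `ℕ^r` that is closed under going down. -/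
def IsFerrers (F : Finset (Fin r →₀ ℕ)) : Prop :=
  IsLowerSet (F : Set (Fin r →₀ ℕ))

/-- The set `𝒦F` of minimal elements of the complement of `F`. -/
def corners (F : Finset (Fin r →₀ ℕ)) : Set (Fin r →₀ ℕ) :=
  {s | Minimal (fun e => e ∉ F) s}

/-- `g = X^s - ∑_{u ∈ F} g_u X^u` with `s ∈ 𝒦F`. -/
def IsFerrersMonic {R : Type*} [CommRing R] (F : Finset (Fin r →₀ ℕ)) (s : Fin r →₀ ℕ)
    (g : MvPolynomial (Fin r) R) : Prop :=
  s ∈ corners F ∧ (MvPolynomial.monomial s 1 - g).support ⊆ F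

/-- A characteristic set: `χ = {g^s | s ∈ 𝒦F}` with every `g^s` an `F`-monic polynomial with
exponent `s`. -/
def IsCharacteristicSet {R : Type*} [CommRing R] (F : Finset (Fin r →₀ ℕ))
    (χ : Finset (MvPolynomial (Fin r) R)) : Prop :=
  ∃ G : (Fin r →₀ ℕ) → MvPolynomial (Fin r) R,
    (∀ s ∈ corners F, IsFerrersMonic F s (G s)) ∧ (χ : Set _) = G '' corners F

/-- `B` is a reduced Gröbner basis of the ideal `I` of `K[X₁, …, X_r]`. -/
structure IsReducedGroebnerBasis {K : Type*} [Field K] (ord : MonomialOrder (Fin r))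
    (I : Ideal (MvPolynomial (Fin r) K)) (B : Set (MvPolynomial (Fin r) K)) : Prop where
  subset : B ⊆ I
  exists_degree_le : ∀ f ∈ I, f ≠ 0 → ∃ g ∈ B, ord.degree g ≤ ord.degree f
  monic : ∀ g ∈ B, ord.leadingCoeff g = 1
  reduced : ∀ g ∈ B, ∀ g' ∈ B, g' ≠ g → ∀ e ∈ g.support, ¬ ord.degree g' ≤ e

/-- A Krull system of `F`-monic polynomials over a local ring `R`: a characteristic set whose
reduction modulo the maximal ideal is injective and yields a reduced Gröbner basis of the ideal
that it generates. -/
structure IsKrullSystem {R : Type*} [CommRing R] [IsLocalRing R] (ord : MonomialOrder (Fin r))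
    (F : Finset (Fin r →₀ ℕ)) (χ : Finset (MvPolynomial (Fin r) R)) : Prop where
  characteristic : IsCharacteristicSet F χ
  injOn : Set.InjOn (MvPolynomial.map (IsLocalRing.residue R)) (χ : Set (MvPolynomial (Fin r) R))
  groebner : IsReducedGroebnerBasis ord
    (Ideal.span (MvPolynomial.map (IsLocalRing.residue R) '' (χ : Set (MvPolynomial (Fin r) R))))
    (MvPolynomial.map (IsLocalRing.residue R) '' (χ : Set (MvPolynomial (Fin r) R)))

end Krull

/-! ### Canonical generating systems -/

section CGS

variable {R : Type*} [CommRing R] {r : ℕ}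

/-- The set `χ = χ_0 ∪ a^{b_1} χ_1 ∪ … ∪ a^{b_x} χ_x` (with `b_0 = 0`). -/
def unionSystem (a : R) (x : ℕ) (b : ℕ → ℕ) (χ : ℕ → Finset (MvPolynomial (Fin r) R)) :
    Set (MvPolynomial (Fin r) R) :=
  {p | ∃ m ≤ x, ∃ g ∈ χ m, p = MvPolynomial.C (a ^ b m) * g}

/-- `|F_{m-1}|`, with the convention `|F_{-1}| = n`. -/
def prevCard (n : ℕ) (F : ℕ → Finset (Fin r →₀ ℕ)) : ℕ → ℕ
  | 0 => n
  | m + 1 => (F m).card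

/-- The exponent `∑_{m=0}^{x} (t - b_m) (|F_{m-1}| - |F_m|)`, where `|F_{-1}| = n`. It is used
only where `b_m ≤ t` and `n ≥ |F_0| ≥ … ≥ |F_x|`, so that no subtraction is truncated. -/
def cardExponent (t n x : ℕ) (b : ℕ → ℕ) (F : ℕ → Finset (Fin r →₀ ℕ)) : ℕ :=
  ∑ m ∈ Finset.range (x + 1), (t - b m) * (prevCard n F m - (F m).card)

/-- The Ferrers diagrams `F_0 ⊃ … ⊃ F_x`, the numbers `0 = b_0 < … < b_x < b_{x+1} = t` and the
Krull systems `χ_0, …, χ_x` form a canonical generating system of the ideal `J` of the affine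
algebra. Only the values of `F`, `χ` at `0, …, x` and of `b` at `0, …, x + 1` matter. -/
structure IsCGS [IsLocalRing R] (ord : MonomialOrder (Fin r)) (a : R) (T : Fin r → R[X])
    (hT : ∀ j, (T j).Monic) (J : Ideal (AffineAlgebra T)) (x : ℕ)
    (F : ℕ → Finset (Fin r →₀ ℕ)) (b : ℕ → ℕ) (χ : ℕ → Finset (MvPolynomial (Fin r) R)) :
    Prop where
  ferrers : ∀ m ≤ x, IsFerrers (F m)
  subset_box : ∀ e ∈ F 0, ∀ j, e j < (T j).natDegree
  chain : ∀ m < x, F (m + 1) ⊂ F m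
  b_zero : b 0 = 0
  b_lt : ∀ m ≤ x, b m < b (m + 1)
  b_last : b (x + 1) = nilpotencyClass a
  /-- Elements of `J` supported in `F_m` have norm at least `b_{m+1}`. -/
  norm_ge : ∀ f ∈ J, ∀ m ≤ x, (rep T hT f).support ⊆ F m → b (m + 1) ≤ polyNorm a (rep T hT f)
  krull : ∀ m ≤ x, IsKrullSystem ord (F m) (χ m)
  krull_mem : ∀ m ≤ x, ∀ g ∈ χ m, toAlg T (MvPolynomial.C (a ^ b m) * g) ∈ J
  generates : Ideal.span (toAlg T '' unionSystem a x b χ) = J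
  /-- Iterated normal forms exist, and any choice of them decides membership in `J`. -/
  nf_exists : ∀ f : AffineAlgebra T, ∃ h, IsNFSequence ord a x χ (rep T hT f) h
  mem_iff : ∀ (f : AffineAlgebra T) (h : ℕ → MvPolynomial (Fin r) R),
    IsNFSequence ord a x χ (rep T hT f) h →
      (f ∈ J ↔ (∀ m ≤ x, b m ≤ polyNorm a (h m)) ∧ h (x + 1) = 0)
  card_eq : Nat.card J =
    Nat.card (IsLocalRing.ResidueField R) ^
      cardExponent (nilpotencyClass a) (∏ j, (T j).natDegree) x b F

end CGS

/-! ### Codes -/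

section Codes

variable {A : Type*} [CommRing A] {l : ℕ}

/-- The subcode of the codewords of `C` whose components before position `i` are zero. -/
def subcode (C : Submodule A (Fin l → A)) (i : Fin l) : Submodule A (Fin l → A) where
  carrier := {c | c ∈ C ∧ ∀ s < i, c s = 0}
  add_mem' := by
    rintro c d ⟨hc, hc'⟩ ⟨hd, hd'⟩
    exact ⟨C.add_mem hc hd, fun s hs => by simp [hc' s hs, hd' s hs]⟩
  zero_mem' := ⟨C.zero_mem, fun _ _ => rfl⟩
  smul_mem' := by
    rintro f c ⟨hc, hc'⟩
    exact ⟨C.smul_mem f hc, fun s hs => by simp [hc' s hs]⟩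

/-- The ideal `π_i(C_i)`: the `i`-th components of the codewords that vanish before `i`. -/
def projIdeal (C : Submodule A (Fin l → A)) (i : Fin l) : Ideal A :=
  (subcode C i).map (LinearMap.proj i)

/-- The rows of the matrix `G` generate `C` as an `A`-module. -/
def IsGeneratorMatrix {ι : Type*} (G : Matrix ι (Fin l) A) (C : Submodule A (Fin l → A)) : Prop :=
  Submodule.span A (Set.range G.row) = C

/-- The row `(0, …, 0, p, h_{i+1}, …, h_l)` with entry `p` in position `i`. -/
def rowVector (i : Fin l) (p : A) (h : Fin l → A) : Fin l → A :=
  fun z => if z < i then 0 else if z = i then p else h z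

end Codes

/-- The row indices of the generator matrix: triples `(j, m, g)` with `0 ≤ m ≤ x_j` and
`g ∈ χ_m^j`. -/
abbrev RowIndex {P : Type*} {k : ℕ} (x : Fin k → ℕ) (χ : Fin k → ℕ → Finset P) : Type _ :=
  Σ (j : Fin k) (m : Fin (x j + 1)), {g : P // g ∈ χ j m}

end ChainCode

end

open ChainCode

/-!
For an ideal `J` of `R[X₁, …, X_r]` containing the `t_j(X_j)` and `0 ≤ v < t`, let `I_v` be the
image of `(J : a ^ v)` over the residue field. The `I_v` increase with `v`, so the sets `D_v` of
their standard exponents form a decreasing chain of Ferrers diagrams in the box of reduced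
exponents. The numbers `b_m` are the levels `v` at which `D_v` jumps, and the Krull system at
`b_m` lifts the reduced Gröbner basis of `I_{b_m}` to elements `g` with `a ^ b_m g ∈ J`: a first
lift may have terms outside `D_{b_m}` with coefficients divisible by `a`, and reducing these away
raises the power of `a` until they vanish.

Multiplication by `a` identifies the quotient by `(J : a)` with the kernel of the projection from
the quotient by `J` to the quotient by `J + ⟨a⟩`. Iterating, the quotient by `J` has length
`∑ v < t, |D_v|`, and summation by parts over the jumps turns this into the formula for the
cardinality. A code is filtered by the number of leading zeros of its words, with graded pieces
the ideals `π_i(C_i)`, and the rows of the generator matrix are words lifting the generators of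
these pieces.
-/

noncomputable section

namespace ChainCode

/-! ### Lengths of modules -/

section Length

theorem natCard_eq_pow_of_length_eq {R M : Type*} [CommRing R] [IsLocalRing R] [AddCommGroup M]
    [Module R M] {n : ℕ} (h : Module.length R M = n) :
    Nat.card M = Nat.card (IsLocalRing.ResidueField R) ^ n := by
  have hM : IsFiniteLength R M := Module.length_ne_top_iff.mp (h ▸ ENat.natCast_ne_top n)
  induction hM generalizing n with
  | of_subsingleton =>
    rw [Module.length_eq_zero, eq_comm, Nat.cast_eq_zero] at h
    rw [h, pow_zero, Nat.card_unique]
  | @of_simple_quotient M _ _ N _ hN ih =>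
    obtain ⟨m, hm⟩ := ENat.ne_top_iff_exists.mp (Module.length_ne_top_iff.mpr hN)
    obtain ⟨I, hI, ⟨e⟩⟩ := isSimpleModule_iff_quot_maximal.mp ‹IsSimpleModule R (M ⧸ N)›
    obtain rfl := IsLocalRing.eq_maximalIdeal hI
    have hn : n = m + 1 := by
      rw [Module.length_eq_add_of_exact N.subtype N.mkQ N.subtype_injective N.mkQ_surjective
        (LinearMap.exact_subtype_mkQ N), ← hm, Module.length_eq_one] at h
      exact_mod_cast h.symm
    rw [Submodule.card_eq_card_quotient_mul_card N, ih hm.symm, Nat.card_congr e.toEquiv, hn,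
      pow_succ]
    rfl

variable {R : Type*} [CommRing R]

theorem length_quotient_comap {A B : Type*} [CommRing A] [CommRing B] [Algebra R A] [Algebra R B]
    {f : A →ₐ[R] B} (hf : Function.Surjective f) (I : Ideal B) :
    Module.length R (A ⧸ I.comap f) = Module.length R (B ⧸ I) :=
  (Ideal.quotientEquivAlgOfEq R (by ext; simp [Ideal.Quotient.eq_zero_iff_mem]) |>.trans
    (Ideal.quotientKerAlgEquivOfSurjective
      (f := (Ideal.Quotient.mkₐ R I).comp f)
      ((Ideal.Quotient.mkₐ_surjective R I).comp hf))).toLinearEquiv.length_eq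

variable {P : Type*} [CommRing P]

theorem colon_singleton_one (J : Ideal P) : J.colon {1} = J := by
  ext p
  rw [Submodule.mem_colon_singleton, smul_eq_mul, mul_one]

theorem colon_colon_pow (J : Ideal P) (a : P) (v : ℕ) :
    (J.colon {a}).colon {a ^ v} = J.colon {a ^ (v + 1)} := by
  ext p
  simp only [Submodule.mem_colon_singleton, smul_eq_mul, pow_succ, mul_assoc]

variable [Algebra R P]

theorem length_quotient_eq_add_colon (J : Ideal P) (a : P) :
    Module.length R (P ⧸ J) =
      Module.length R (P ⧸ J.colon {a}) + Module.length R (P ⧸ J ⊔ Ideal.span {a}) := by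
  let mulA : (P ⧸ J.colon {a}) →ₗ[R] P ⧸ J :=
    ((J.colon {a}).mapQ J (LinearMap.mulRight P a) fun p hp =>
      Submodule.mem_colon_singleton.mp hp).restrictScalars R
  let proj : (P ⧸ J) →ₗ[R] P ⧸ J ⊔ Ideal.span {a} :=
    (Ideal.Quotient.factorₐ R (le_sup_left : J ≤ J ⊔ Ideal.span {a})).toLinearMap
  have mulA_mk (p : P) : mulA (Ideal.Quotient.mk _ p) = Ideal.Quotient.mk _ (p * a) := rfl
  have proj_mk (p : P) : proj (Ideal.Quotient.mk _ p) = Ideal.Quotient.mk _ p := rfl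
  refine Module.length_eq_add_of_exact mulA proj ?_ ?_ ?_
  · refine (injective_iff_map_eq_zero mulA).mpr fun p hp => ?_
    obtain ⟨p, rfl⟩ := Ideal.Quotient.mk_surjective p
    rw [mulA_mk, Ideal.Quotient.eq_zero_iff_mem] at hp
    exact Ideal.Quotient.eq_zero_iff_mem.mpr (Submodule.mem_colon_singleton.mpr hp)
  · exact Ideal.Quotient.factor_surjective le_sup_left
  · intro p
    obtain ⟨p, rfl⟩ := Ideal.Quotient.mk_surjective p
    rw [proj_mk, Ideal.Quotient.eq_zero_iff_mem]
    constructor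
    · intro hp
      obtain ⟨j, hj, c, hc, rfl⟩ := Submodule.mem_sup.mp hp
      obtain ⟨c, rfl⟩ := Ideal.mem_span_singleton'.mp hc
      refine ⟨Ideal.Quotient.mk _ c, ?_⟩
      rw [mulA_mk, map_add, Ideal.Quotient.eq_zero_iff_mem.mpr hj, zero_add]
    · rintro ⟨c, hc⟩
      obtain ⟨c, rfl⟩ := Ideal.Quotient.mk_surjective c
      rw [mulA_mk, eq_comm, Ideal.Quotient.eq] at hc
      rw [← sub_add_cancel p (c * a)]
      exact add_mem (Ideal.mem_sup_left hc)
        (Ideal.mem_sup_right (Ideal.mul_mem_left _ _ (Ideal.mem_span_singleton_self a)))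

theorem length_quotient_eq_sum_colon (J : Ideal P) (a : P) {t : ℕ} (ht : a ^ t ∈ J) :
    Module.length R (P ⧸ J) =
      ∑ v ∈ Finset.range t, Module.length R (P ⧸ J.colon {a ^ v} ⊔ Ideal.span {a}) := by
  induction t generalizing J with
  | zero =>
    rw [pow_zero, ← Ideal.eq_top_iff_one] at ht
    rw [ht, Finset.sum_range_zero, Module.length_eq_zero]
  | succ t ih =>
    rw [length_quotient_eq_add_colon J a, Finset.sum_range_succ', pow_zero, colon_singleton_one,
      ih (J.colon {a}) (Submodule.mem_colon_singleton.mpr (by rwa [smul_eq_mul, ← pow_succ]))]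
    exact congrArg (· + _) (Finset.sum_congr rfl fun v _ => by rw [colon_colon_pow])

theorem length_eq_add_length_map {A M M' : Type*} [Ring A] [Algebra R A] [AddCommGroup M]
    [Module A M] [Module R M] [IsScalarTower R A M] [AddCommGroup M'] [Module A M'] [Module R M']
    [IsScalarTower R A M'] (f : M →ₗ[A] M') (N : Submodule A M) :
    Module.length R N =
      Module.length R (N ⊓ LinearMap.ker f : Submodule A M) + Module.length R (N.map f) := by
  refine Module.length_eq_add_of_exact
    ((Submodule.inclusion (inf_le_left : N ⊓ LinearMap.ker f ≤ N)).restrictScalars R)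
    ((f.submoduleMap N).restrictScalars R) (Submodule.inclusion_injective inf_le_left)
    (f.submoduleMap_surjective N) fun c => ?_
  simp [Subtype.ext_iff]

end Length

/-! ### Standard exponents -/

section Division

variable {R : Type*} [CommRing R] {σ : Type*}

theorem exists_sub_mem_span (ord : MonomialOrder σ) {B : Set (MvPolynomial σ R)}
    (hB : ∀ g ∈ B, IsUnit (ord.leadingCoeff g)) (f : MvPolynomial σ R) :
    ∃ p, f - p ∈ Ideal.span B ∧ ∀ e ∈ p.support, ∀ g ∈ B, ¬ ord.degree g ≤ e := by
  obtain ⟨q, p, hf, -, hp⟩ := ord.div_set hB f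
  refine ⟨p, ?_, hp⟩
  rw [hf, add_sub_cancel_right, Finsupp.linearCombination_apply]
  exact Submodule.sum_mem _ fun g _ => Ideal.mul_mem_left _ _ (Ideal.subset_span g.2)

theorem length_restrictSupport (D : Finset (σ →₀ ℕ)) :
    Module.length R (MvPolynomial.restrictSupport R (D : Set (σ →₀ ℕ))) =
      D.card * Module.length R R := by
  rw [(MvPolynomial.basisRestrictSupport R (D : Set (σ →₀ ℕ))).repr.length_eq,
    Module.length_finsupp]
  simp

end Division

section Standard

variable {K : Type*} [Field K] {σ : Type*} (ord : MonomialOrder σ)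

/-- The standard exponents of an ideal `I` are those that are not the degree of a nonzero element
of `I`; they index the monomials that form a basis of the quotient by `I`. -/
def IsStandard (I : Ideal (MvPolynomial σ K)) (e : σ →₀ ℕ) : Prop :=
  ∀ f ∈ I, f ≠ 0 → ord.degree f ≠ e

variable {ord} {I I' : Ideal (MvPolynomial σ K)}

theorem IsStandard.anti (h : I ≤ I') {e : σ →₀ ℕ} (he : IsStandard ord I' e) :
    IsStandard ord I e :=
  fun f hf => he f (h hf)

theorem IsStandard.of_le {e e' : σ →₀ ℕ} (he : IsStandard ord I e) (hle : e' ≤ e) :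
    IsStandard ord I e' := by
  classical
  rintro f hf hf0 rfl
  have hm : MvPolynomial.monomial (e - ord.degree f) (1 : K) ≠ 0 := by simp
  refine he _ (I.mul_mem_left (MvPolynomial.monomial (e - ord.degree f) 1) hf)
    (mul_ne_zero hm hf0) ?_
  rw [MonomialOrder.degree_mul hm hf0, MonomialOrder.degree_monomial, if_neg one_ne_zero,
    tsub_add_cancel_of_le hle]

theorem eq_zero_of_isStandard {f : MvPolynomial σ K} (hf : f ∈ I)
    (h : ∀ e ∈ f.support, IsStandard ord I e) : f = 0 := by
  by_contra h0
  exact h _ (ord.degree_mem_support h0) f hf h0 rfl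

variable (ord) in
theorem exists_sub_mem_isStandard (I : Ideal (MvPolynomial σ K)) (f : MvPolynomial σ K) :
    ∃ p, f - p ∈ I ∧ ∀ e ∈ p.support, IsStandard ord I e := by
  obtain ⟨p, hfp, hp⟩ := exists_sub_mem_span ord (B := {g | g ∈ I ∧ g ≠ 0})
    (fun g hg => (ord.leadingCoeff_ne_zero_iff.mpr hg.2).isUnit) f
  exact ⟨p, Ideal.span_le.mpr (fun g hg => hg.1) hfp,
    fun e he g hg hg0 hd => hp e he g ⟨hg, hg0⟩ hd.le⟩

theorem eq_of_forall_isStandard (hle : I ≤ I')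
    (h : ∀ e, IsStandard ord I e → IsStandard ord I' e) : I = I' := by
  refine hle.antisymm fun f hf => ?_
  obtain ⟨p, hfp, hp⟩ := exists_sub_mem_isStandard ord I f
  have hpI' : p ∈ I' := (Submodule.sub_mem_iff_right I' hf).mp (hle hfp)
  rwa [eq_zero_of_isStandard hpI' fun e he => h e (hp e he), sub_zero] at hfp

theorem span_eq_of_exists_degree_le {B : Set (MvPolynomial σ K)} (hB : B ⊆ I) (h0 : 0 ∉ B)
    (hdeg : ∀ e, ¬ IsStandard ord I e → ∃ g ∈ B, ord.degree g ≤ e) : Ideal.span B = I := by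
  refine eq_of_forall_isStandard (ord := ord) (Ideal.span_le.mpr hB) fun e he => ?_
  by_contra hn
  obtain ⟨g, hg, hge⟩ := hdeg e hn
  exact he.of_le hge g (Ideal.subset_span hg) (ne_of_mem_of_not_mem hg h0) rfl

theorem length_quotient_eq_card {D : Finset (σ →₀ ℕ)} (hD : ∀ e, e ∈ D ↔ IsStandard ord I e) :
    Module.length K (MvPolynomial σ K ⧸ I) = D.card := by
  let toQuotient : MvPolynomial.restrictSupport K (D : Set (σ →₀ ℕ)) →ₗ[K] MvPolynomial σ K ⧸ I :=
    (Ideal.Quotient.mkₐ K I).toLinearMap.domRestrict _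
  have hbij : Function.Bijective toQuotient := by
    refine ⟨(injective_iff_map_eq_zero toQuotient).mpr fun p hp => ?_, fun f => ?_⟩
    · exact Subtype.ext (eq_zero_of_isStandard (Ideal.Quotient.eq_zero_iff_mem.mp hp)
        fun e he => (hD e).mp (p.2 he))
    · obtain ⟨f, rfl⟩ := Ideal.Quotient.mk_surjective f
      obtain ⟨p, hfp, hp⟩ := exists_sub_mem_isStandard ord I f
      exact ⟨⟨p, fun e he => (hD e).mpr (hp e he)⟩, (Ideal.Quotient.eq.mpr hfp).symm⟩
  rw [← (LinearEquiv.ofBijective toQuotient hbij).length_eq, length_restrictSupport,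
    Module.length_eq_one, mul_one]

end Standard

section Corners

variable {r : ℕ} {F : Finset (Fin r →₀ ℕ)}

theorem exists_corner_le {e : Fin r →₀ ℕ} (he : e ∉ F) : ∃ s ∈ corners F, s ≤ e := by
  obtain ⟨s, hs, hm⟩ := exists_minimal_le_of_wellFoundedLT (· ∉ F) e he
  exact ⟨s, hm, hs⟩

theorem notMem_of_corner_le (hF : IsFerrers F) {s e : Fin r →₀ ℕ} (hs : s ∈ corners F)
    (hse : s ≤ e) : e ∉ F :=
  fun he => hs.1 (hF hse he)

theorem finite_corners (F : Finset (Fin r →₀ ℕ)) : (corners F).Finite :=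
  (setOfPred_minimal_antichain _).finite_of_partiallyWellOrderedOn
    (Set.isPWO_of_wellQuasiOrderedLE _)

end Corners

/-! ### The affine algebra is free on the monomials in the box -/

section Free

variable {R : Type*} [CommRing R] {r : ℕ}

/-- The box `∏ {0, …, n_j - 1}` of the exponents of reduced polynomials. -/
def box (T : Fin r → R[X]) : Finset (Fin r →₀ ℕ) :=
  (Fintype.piFinset fun j => Finset.range (T j).natDegree).map
    Finsupp.equivFunOnFinite.symm.toEmbedding

variable {T : Fin r → R[X]}

theorem mem_box {e : Fin r →₀ ℕ} : e ∈ box T ↔ ∀ j, e j < (T j).natDegree := by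
  simp [box]

variable (T) in
theorem card_box : (box T).card = ∏ j, (T j).natDegree := by
  simp [box]

theorem isReducedPoly_iff {p : MvPolynomial (Fin r) R} :
    IsReducedPoly T p ↔ p ∈ MvPolynomial.restrictSupport R (box T : Set (Fin r →₀ ℕ)) := by
  rw [MvPolynomial.mem_restrictSupport_iff]
  exact forall₂_congr fun e _ => mem_box.symm

theorem IsReducedPoly.sub {p p' : MvPolynomial (Fin r) R} (hp : IsReducedPoly T p)
    (hp' : IsReducedPoly T p') : IsReducedPoly T (p - p') := by
  rw [isReducedPoly_iff] at *
  exact sub_mem hp hp'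

variable (T) in
/-- The `R`-linear form sending `X^e` to `∏ j, coeff (X ^ e j mod T j) (u j)`: the coefficient at
`X^u` of the reduced representative. It vanishes on `⟨t₁, …, t_r⟩`, which is why reduced
representatives are unique. -/
def boxCoord (u : Fin r →₀ ℕ) : MvPolynomial (Fin r) R →ₗ[R] R :=
  (MvPolynomial.basisMonomials (Fin r) R).constr R fun e =>
    ∏ j, ((Polynomial.X ^ e j : R[X]) %ₘ T j).coeff (u j)

theorem boxCoord_monomial (u e : Fin r →₀ ℕ) (c : R) :
    boxCoord T u (MvPolynomial.monomial e c) =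
      c * ∏ j, ((Polynomial.X ^ e j : R[X]) %ₘ T j).coeff (u j) := by
  have hsmul : MvPolynomial.monomial e c = c • MvPolynomial.basisMonomials (Fin r) R e := by
    simp [MvPolynomial.smul_monomial]
  rw [hsmul, map_smul, boxCoord, Module.Basis.constr_basis, smul_eq_mul]

theorem boxCoord_monomial_mul_aeval (u e : Fin r →₀ ℕ) (c : R) (i : Fin r) (p : R[X]) :
    boxCoord T u (MvPolynomial.monomial e c * Polynomial.aeval (MvPolynomial.X i) p) =
      c * ((Polynomial.X ^ e i * p) %ₘ T i).coeff (u i) *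
        ∏ j ∈ Finset.univ.erase i, ((Polynomial.X ^ e j : R[X]) %ₘ T j).coeff (u j) := by
  induction p using Polynomial.induction_on' with
  | add p p' hp hp' =>
    rw [map_add, mul_add, map_add, hp, hp', mul_add, Polynomial.add_modByMonic,
      Polynomial.coeff_add]
    ring
  | monomial k d =>
    have hmul : MvPolynomial.monomial e c *
        Polynomial.aeval (MvPolynomial.X i) (Polynomial.monomial k d) =
          MvPolynomial.monomial (e + Finsupp.single i k) (c * d) := by
      rw [Polynomial.aeval_monomial, MvPolynomial.algebraMap_eq,
        MvPolynomial.C_mul_X_pow_eq_monomial, MvPolynomial.monomial_mul]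
    have herase : ∏ j ∈ Finset.univ.erase i,
        ((Polynomial.X ^ (e + Finsupp.single i k) j : R[X]) %ₘ T j).coeff (u j) =
          ∏ j ∈ Finset.univ.erase i, ((Polynomial.X ^ e j : R[X]) %ₘ T j).coeff (u j) :=
      Finset.prod_congr rfl fun j hj => by
        rw [Finsupp.add_apply, Finsupp.single_eq_of_ne (Finset.ne_of_mem_erase hj), add_zero]
    rw [hmul, boxCoord_monomial, ← Finset.mul_prod_erase _ _ (Finset.mem_univ i), herase,
      Finsupp.add_apply, Finsupp.single_eq_same, ← Polynomial.smul_X_eq_monomial, mul_smul_comm,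
      Polynomial.smul_modByMonic, Polynomial.coeff_smul, pow_add, smul_eq_mul]
    ring

variable (hT : ∀ j, (T j).Monic)
include hT

theorem boxCoord_eq_zero (u : Fin r →₀ ℕ) {p : MvPolynomial (Fin r) R}
    (hp : p ∈ definingIdeal T) : boxCoord T u p = 0 := by
  obtain ⟨q, rfl⟩ := Ideal.mem_span_range_iff_exists_fun.mp hp
  rw [map_sum]
  refine Finset.sum_eq_zero fun i _ => ?_
  induction q i using MvPolynomial.induction_on' with
  | add p p' hp hp' => rw [add_mul, map_add, hp, hp', add_zero]
  | monomial e c =>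
    rw [boxCoord_monomial_mul_aeval, Polynomial.mul_self_modByMonic (hT i), Polynomial.coeff_zero,
      mul_zero, zero_mul]

theorem boxCoord_monomial_of_mem_box {u e : Fin r →₀ ℕ} (he : e ∈ box T) (c : R) :
    boxCoord T u (MvPolynomial.monomial e c) = if e = u then c else 0 := by
  nontriviality R
  have hmod (j : Fin r) : (Polynomial.X ^ e j : R[X]) %ₘ T j = Polynomial.X ^ e j := by
    rw [Polynomial.modByMonic_eq_self_iff (hT j), Polynomial.degree_X_pow,
      Polynomial.degree_eq_natDegree (hT j).ne_zero]
    exact_mod_cast mem_box.mp he j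
  simp only [boxCoord_monomial, hmod, Polynomial.coeff_X_pow]
  split_ifs with h
  · simp [h]
  · obtain ⟨j, hj⟩ := Finsupp.ne_iff.mp h
    rw [Finset.prod_eq_zero (Finset.mem_univ j) (if_neg hj.symm), mul_zero]

theorem IsReducedPoly.boxCoord_eq_coeff {p : MvPolynomial (Fin r) R} (hp : IsReducedPoly T p)
    (u : Fin r →₀ ℕ) : boxCoord T u p = p.coeff u := by
  classical
  conv_lhs => rw [p.as_sum]
  rw [map_sum, Finset.sum_congr rfl fun e he =>
    boxCoord_monomial_of_mem_box hT (mem_box.mpr (hp e he)) _, Finset.sum_ite_eq']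
  split_ifs with h
  · rfl
  · exact (MvPolynomial.notMem_support_iff.mp h).symm

theorem IsReducedPoly.eq_zero_of_mem {p : MvPolynomial (Fin r) R} (hp : IsReducedPoly T p)
    (hmem : p ∈ definingIdeal T) : p = 0 := by
  ext u
  rw [← hp.boxCoord_eq_coeff hT, boxCoord_eq_zero hT u hmem, MvPolynomial.coeff_zero]

theorem isReducedPoly_rep (f : AffineAlgebra T) : IsReducedPoly T (rep T hT f) :=
  (exists_reduced T hT f).choose_spec.1

theorem toAlg_rep (f : AffineAlgebra T) : toAlg T (rep T hT f) = f :=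
  (exists_reduced T hT f).choose_spec.2

theorem rep_toAlg {p : MvPolynomial (Fin r) R} (hp : IsReducedPoly T p) :
    rep T hT (toAlg T p) = p :=
  sub_eq_zero.mp (((isReducedPoly_rep hT _).sub hp).eq_zero_of_mem hT
    (Ideal.Quotient.eq.mp (toAlg_rep hT _)))

theorem length_affineAlgebra :
    Module.length R (AffineAlgebra T) = (∏ j, (T j).natDegree : ℕ) * Module.length R R := by
  let ofReduced : MvPolynomial.restrictSupport R (box T : Set (Fin r →₀ ℕ)) →ₗ[R]
      AffineAlgebra T := (Ideal.Quotient.mkₐ R (definingIdeal T)).toLinearMap.domRestrict _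
  have hbij : Function.Bijective ofReduced := by
    refine ⟨(injective_iff_map_eq_zero ofReduced).mpr fun p hp => ?_, fun f => ?_⟩
    · exact Subtype.ext ((isReducedPoly_iff.mpr p.2).eq_zero_of_mem hT
        (Ideal.Quotient.eq_zero_iff_mem.mp hp))
    · exact ⟨⟨rep T hT f, isReducedPoly_iff.mp (isReducedPoly_rep hT f)⟩, toAlg_rep hT f⟩
  rw [← (LinearEquiv.ofBijective ofReduced hbij).length_eq, length_restrictSupport, card_box]

end Free

/-! ### Norms and normal forms over a chain ring -/

section Norm

variable {R : Type*} [CommRing R] {r : ℕ} {a : R}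

theorem le_chainNorm_iff {i : ℕ} (hi : i ≤ nilpotencyClass a) {c : R} :
    i ≤ chainNorm a c ↔ a ^ i ∣ c := by
  classical
  refine ⟨fun h => (pow_dvd_pow a h).trans ?_, fun h => Nat.le_findGreatest hi h⟩
  exact Nat.findGreatest_spec (P := fun i => a ^ i ∣ c) (Nat.zero_le _) (by simp)

theorem polyNorm_le (f : MvPolynomial (Fin r) R) (e : Fin r →₀ ℕ) :
    polyNorm a f ≤ chainNorm a (f.coeff e) :=
  ciInf_le (OrderBot.bddBelow _) e

theorem le_polyNorm_iff {i : ℕ} (hi : i ≤ nilpotencyClass a) {f : MvPolynomial (Fin r) R} :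
    i ≤ polyNorm a f ↔ MvPolynomial.C (a ^ i) ∣ f := by
  rw [MvPolynomial.C_dvd_iff_dvd_coeff]
  exact ⟨fun h e => (le_chainNorm_iff hi).mp (h.trans (polyNorm_le f e)),
    fun h => le_ciInf fun e => (le_chainNorm_iff hi).mpr (h e)⟩

variable [IsLocalRing R] (ha : IsLocalRing.maximalIdeal R = Ideal.span {a})
include ha

theorem residue_eq_zero_iff_dvd {c : R} : IsLocalRing.residue R c = 0 ↔ a ∣ c := by
  rw [IsLocalRing.residue_eq_zero_iff, ha, Ideal.mem_span_singleton]

theorem not_isUnit_iff_dvd {c : R} : ¬ IsUnit c ↔ a ∣ c := by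
  rw [← residue_eq_zero_iff_dvd ha, ← IsLocalRing.residue_ne_zero_iff_isUnit, not_not]

theorem isNilpotent_of_isArtinianRing [IsArtinianRing R] : IsNilpotent a := by
  obtain ⟨n, hn⟩ := (isArtinianRing_iff_isNilpotent_maximalIdeal R).mp inferInstance
  refine ⟨n, ?_⟩
  rwa [ha, Ideal.span_singleton_pow, Ideal.zero_eq_bot, Ideal.span_singleton_eq_bot] at hn

theorem map_residue_eq_zero_iff {σ : Type*} {f : MvPolynomial σ R} :
    MvPolynomial.map (IsLocalRing.residue R) f = 0 ↔ MvPolynomial.C a ∣ f := by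
  rw [MvPolynomial.C_dvd_iff_dvd_coeff, MvPolynomial.ext_iff]
  refine forall_congr' fun e => ?_
  rw [MvPolynomial.coeff_map, MvPolynomial.coeff_zero, residue_eq_zero_iff_dvd ha]

theorem dvd_of_pow_mul_eq_zero {v : ℕ} (hv : v < nilpotencyClass a) {c : R}
    (h : a ^ v * c = 0) : a ∣ c := by
  rw [← not_isUnit_iff_dvd ha]
  intro hc
  have hav : a ^ v = 0 := hc.mul_left_eq_zero.mp h
  exact (Nat.sInf_le (s := {k | a ^ k = 0}) hav).not_gt hv

theorem pow_succ_dvd_pow_mul_iff {v : ℕ} (hv : v < nilpotencyClass a) {c : R} :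
    a ^ (v + 1) ∣ a ^ v * c ↔ a ∣ c := by
  rw [pow_succ]
  refine ⟨fun ⟨d, hd⟩ => ?_, fun h => mul_dvd_mul_left _ h⟩
  have hsub : a ^ v * (c - a * d) = 0 := by rw [mul_sub, hd, mul_assoc, sub_self]
  exact (dvd_sub_left (dvd_mul_right a d)).mp (dvd_of_pow_mul_eq_zero ha hv hsub)

theorem chainNorm_pow_mul_eq_iff {v : ℕ} (hv : v < nilpotencyClass a) {c : R} :
    chainNorm a (a ^ v * c) = v ↔ IsUnit c := by
  have hle : v ≤ chainNorm a (a ^ v * c) := (le_chainNorm_iff hv.le).mpr (dvd_mul_right _ _)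
  rw [← not_iff_not, not_isUnit_iff_dvd ha, ← pow_succ_dvd_pow_mul_iff ha hv, ← le_chainNorm_iff hv]
  lia

theorem length_eq_nilpotencyClass (hnil : IsNilpotent a) :
    Module.length R R = nilpotencyClass a := by
  have hterm : ∀ v ∈ Finset.range (nilpotencyClass a),
      Module.length R (R ⧸ (⊥ : Ideal R).colon {a ^ v} ⊔ Ideal.span {a}) = 1 := by
    intro v hv
    have hle : (⊥ : Ideal R).colon {a ^ v} ≤ Ideal.span {a} := fun c hc =>
      Ideal.mem_span_singleton.mpr (dvd_of_pow_mul_eq_zero ha (Finset.mem_range.mp hv)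
        (by simpa [Submodule.mem_colon_singleton, mul_comm] using hc))
    rw [sup_eq_right.mpr hle, ← ha, Module.length_eq_one_iff, isSimpleModule_iff_isCoatom]
    exact (IsLocalRing.maximalIdeal.isMaximal R).out
  calc Module.length R R = Module.length R (R ⧸ (⊥ : Ideal R)) :=
        (Submodule.quotEquivOfEqBot _ rfl).symm.length_eq
    _ = ∑ v ∈ Finset.range (nilpotencyClass a), 1 := by
        rw [length_quotient_eq_sum_colon (R := R) ⊥ a (t := nilpotencyClass a)
          (by rw [pow_nilpotencyClass hnil]; exact zero_mem _), Finset.sum_congr rfl hterm]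
    _ = nilpotencyClass a := by simp

end Norm

section ResidueMonic

variable {R : Type*} [CommRing R] [IsLocalRing R] {r : ℕ} {a : R} {ord : MonomialOrder (Fin r)}

/-- A polynomial over a local ring with coefficient `1` at `s`, whose image over the residue field
has degree `s`. Over a chain ring its multiples by powers of the generator of the maximal ideal
have leading degree `s`. -/
structure IsResidueMonic (ord : MonomialOrder (Fin r)) (s : Fin r →₀ ℕ)
    (g : MvPolynomial (Fin r) R) : Prop where
  coeff_eq_one : g.coeff s = 1
  degree_map : ord.degree (MvPolynomial.map (IsLocalRing.residue R) g) = s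

variable {s : Fin r →₀ ℕ} {f g : MvPolynomial (Fin r) R}

variable (ha : IsLocalRing.maximalIdeal R = Ideal.span {a})
include ha

theorem IsResidueMonic.dvd_coeff_of_lt (hg : IsResidueMonic ord s g) {e : Fin r →₀ ℕ}
    (he : ord.toSyn s < ord.toSyn e) : a ∣ g.coeff e := by
  rw [← residue_eq_zero_iff_dvd ha, ← MvPolynomial.coeff_map]
  exact ord.coeff_eq_zero_of_lt (by rwa [hg.degree_map])

theorem IsResidueMonic.isLeadingDegree_iff (hg : IsResidueMonic ord s g) {v : ℕ}
    (hv : v < nilpotencyClass a) {e : Fin r →₀ ℕ} :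
    IsLeadingDegree ord a (MvPolynomial.C (a ^ v) * g) e ↔ e = s := by
  have hunit : ∀ e, chainNorm a ((MvPolynomial.C (a ^ v) * g).coeff e) = v ↔
      IsUnit (g.coeff e) := fun e => by
    rw [MvPolynomial.coeff_C_mul, chainNorm_pow_mul_eq_iff ha hv]
  have hs : IsUnit (g.coeff s) := hg.coeff_eq_one ▸ isUnit_one
  have hnorm : polyNorm a (MvPolynomial.C (a ^ v) * g) = v :=
    le_antisymm ((polyNorm_le _ s).trans ((hunit s).mpr hs).le)
      ((le_polyNorm_iff hv.le).mpr (dvd_mul_right _ _))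
  have hle : ∀ e, IsUnit (g.coeff e) → ord.toSyn e ≤ ord.toSyn s := fun e he =>
    not_lt.mp fun h => (not_isUnit_iff_dvd ha).mpr (hg.dvd_coeff_of_lt ha h) he
  simp only [IsLeadingDegree, hnorm, hunit]
  refine ⟨fun h => ord.toSyn.injective (le_antisymm (hle e h.1) (h.2 s hs)), ?_⟩
  rintro rfl
  exact ⟨hs, hle⟩

theorem IsResidueMonic.lStep_iff (hg : IsResidueMonic ord s g) {v : ℕ}
    (hv : v < nilpotencyClass a) {h : MvPolynomial (Fin r) R} :
    LStep ord a (MvPolynomial.C (a ^ v) * g) f h ↔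
      ∃ i c, c * a ^ v = f.coeff (i + s) ∧ f.coeff (i + s) ≠ 0 ∧
        h = f - MvPolynomial.monomial i c * (MvPolynomial.C (a ^ v) * g) := by
  simp only [LStep, hg.isLeadingDegree_iff ha hv]
  constructor
  · rintro ⟨_, i, c, rfl, h0, hc, rfl⟩
    rw [MvPolynomial.coeff_C_mul, hg.coeff_eq_one, mul_one] at h0 hc
    exact ⟨i, c, hc, hc ▸ h0, rfl⟩
  · rintro ⟨i, c, hc, h0, rfl⟩
    refine ⟨s, i, c, rfl, ?_, ?_, rfl⟩ <;>
      rw [MvPolynomial.coeff_C_mul, hg.coeff_eq_one, mul_one, hc]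
    exact h0

theorem IsResidueMonic.exists_lStep_iff (hg : IsResidueMonic ord s g) {v : ℕ}
    (hv : v < nilpotencyClass a) :
    (∃ h, LStep ord a (MvPolynomial.C (a ^ v) * g) f h) ↔
      ∃ e, s ≤ e ∧ f.coeff e ≠ 0 ∧ a ^ v ∣ f.coeff e := by
  simp only [hg.lStep_iff ha hv]
  constructor
  · rintro ⟨_, i, c, hc, h0, -⟩
    exact ⟨i + s, le_add_self, h0, hc ▸ dvd_mul_left _ _⟩
  · rintro ⟨e, hse, h0, c, hc⟩
    rw [← tsub_add_cancel_of_le hse] at h0 hc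
    exact ⟨_, e - s, c, by rw [hc, mul_comm], h0, rfl⟩

theorem IsResidueMonic.pow_succ_dvd_coeff_monomial_mul (hg : IsResidueMonic ord s g) {v : ℕ}
    {i e : Fin r →₀ ℕ} {c : R} (hc : a ^ v ∣ c) (he : ord.toSyn (i + s) < ord.toSyn e) :
    a ^ (v + 1) ∣ (MvPolynomial.monomial i c * g).coeff e := by
  classical
  rw [MvPolynomial.coeff_monomial_mul']
  split_ifs with hle
  · rw [← add_tsub_cancel_of_le hle, map_add, map_add, add_lt_add_iff_left] at he
    exact pow_succ a v ▸ mul_dvd_mul hc (hg.dvd_coeff_of_lt ha he)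
  · exact dvd_zero _

end ResidueMonic

section NormalForm

variable {R : Type*} [CommRing R] [IsLocalRing R] {r : ℕ} {a : R} {ord : MonomialOrder (Fin r)}
  {F : Finset (Fin r →₀ ℕ)} {G : (Fin r →₀ ℕ) → MvPolynomial (Fin r) R}
  {f h : MvPolynomial (Fin r) R}

variable (ha : IsLocalRing.maximalIdeal R = Ideal.span {a})
include ha

theorem isNormal_C_pow_mul_iff (hF : IsFerrers F) (hG : ∀ s ∈ corners F, IsResidueMonic ord s (G s))
    {v : ℕ} (hv : v < nilpotencyClass a) :
    IsNormal ord a ((fun s => MvPolynomial.C (a ^ v) * G s) '' corners F) f ↔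
      ∀ e, f.coeff e ≠ 0 → a ^ v ∣ f.coeff e → e ∈ F := by
  constructor
  · intro hf e he hdvd
    by_contra hn
    obtain ⟨s, hs, hse⟩ := exists_corner_le hn
    obtain ⟨h, hstep⟩ := ((hG s hs).exists_lStep_iff ha hv).mpr ⟨e, hse, he, hdvd⟩
    exact hf ⟨h, _, ⟨s, hs, rfl⟩, hstep⟩
  · rintro hf ⟨h, _, ⟨s, hs, rfl⟩, hstep⟩
    obtain ⟨e, hse, he, hdvd⟩ := ((hG s hs).exists_lStep_iff ha hv).mp ⟨h, hstep⟩
    exact notMem_of_corner_le hF hs hse (hf e he hdvd)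

theorem isNormal_iff_support_subset (hF : IsFerrers F)
    (hG : ∀ s ∈ corners F, IsResidueMonic ord s (G s)) (hpos : 0 < nilpotencyClass a) :
    IsNormal ord a (G '' corners F) f ↔ f.support ⊆ F := by
  simpa [Finset.subset_iff] using isNormal_C_pow_mul_iff (f := f) ha hF hG hpos

theorem exists_lStep_of_not_dvd (hG : ∀ s ∈ corners F, IsResidueMonic ord s (G s)) {v : ℕ}
    (hpos : 0 < nilpotencyClass a) {e : Fin r →₀ ℕ} (he : e ∉ F)
    (hfv : ∀ e ∉ F, a ^ v ∣ f.coeff e) (hfe : ¬ a ^ (v + 1) ∣ f.coeff e)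
    (hmax : ∀ e' ∉ F, ord.toSyn e < ord.toSyn e' → a ^ (v + 1) ∣ f.coeff e') :
    ∃ h, (∃ g ∈ G '' corners F, LStep ord a g f h) ∧ (∀ e' ∉ F, a ^ v ∣ h.coeff e') ∧
      ∀ e' ∉ F, ord.toSyn e ≤ ord.toSyn e' → a ^ (v + 1) ∣ h.coeff e' := by
  classical
  obtain ⟨s, hs, hse⟩ := exists_corner_le he
  obtain ⟨i, rfl⟩ : ∃ i, e = i + s := ⟨e - s, (tsub_add_cancel_of_le hse).symm⟩
  refine ⟨f - MvPolynomial.monomial i (f.coeff (i + s)) * G s, ⟨G s, ⟨s, hs, rfl⟩, ?_⟩,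
    fun e' he' => ?_, fun e' he' hle => ?_⟩
  · simpa using ((hG s hs).lStep_iff ha hpos).mpr
      ⟨i, f.coeff (i + s), by simp, fun h0 => hfe (h0 ▸ dvd_zero _), rfl⟩
  · rw [MvPolynomial.coeff_sub, MvPolynomial.coeff_monomial_mul']
    refine dvd_sub (hfv e' he') ?_
    split_ifs
    · exact (hfv _ he).mul_right _
    · exact dvd_zero _
  · rw [MvPolynomial.coeff_sub]
    rcases hle.eq_or_lt with h | h
    · rw [← ord.toSyn.injective h, MvPolynomial.coeff_monomial_mul, (hG s hs).coeff_eq_one,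
        mul_one, sub_self]
      exact dvd_zero _
    · exact dvd_sub (hmax e' he' h) ((hG s hs).pow_succ_dvd_coeff_monomial_mul ha (hfv _ he) h)

theorem exists_lReduces_pow_succ_dvd (hG : ∀ s ∈ corners F, IsResidueMonic ord s (G s))
    (hpos : 0 < nilpotencyClass a) {v : ℕ} (f : MvPolynomial (Fin r) R)
    (hf : ∀ e ∉ F, a ^ v ∣ f.coeff e) :
    ∃ h, LReduces ord a (G '' corners F) f h ∧ ∀ e ∉ F, a ^ (v + 1) ∣ h.coeff e := by
  suffices key : ∀ δ : WithTop ord.syn, ∀ f : MvPolynomial (Fin r) R,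
      (∀ e ∉ F, a ^ v ∣ f.coeff e) →
      (∀ e ∉ F, δ ≤ ord.toSyn e → a ^ (v + 1) ∣ f.coeff e) →
      ∃ h, LReduces ord a (G '' corners F) f h ∧ ∀ e ∉ F, a ^ (v + 1) ∣ h.coeff e from
    key ⊤ f hf fun e _ he => absurd he (WithTop.coe_lt_top _).not_ge
  intro δ
  induction δ using WellFoundedLT.induction with | ind δ ih
  intro f hf hδ
  let bad : Set (Fin r →₀ ℕ) := {e | e ∉ F ∧ ¬ a ^ (v + 1) ∣ f.coeff e}
  have hbad : bad.Finite := f.support.finite_toSet.subset fun e he =>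
    MvPolynomial.mem_support_iff.mpr fun h0 => he.2 (h0 ▸ dvd_zero _)
  obtain hempty | hne := bad.eq_empty_or_nonempty
  · exact ⟨f, .refl, fun e he => not_not.mp fun hn => hempty.subset ⟨he, hn⟩⟩
  obtain ⟨e, ⟨heF, hfe⟩, hmax⟩ := bad.exists_max_image ord.toSyn hbad hne
  obtain ⟨h, hstep, hh, hlt⟩ := exists_lStep_of_not_dvd ha hG hpos heF hf hfe
    fun e' he' hlt => not_not.mp fun hn => (hmax e' ⟨he', hn⟩).not_gt hlt
  obtain ⟨h', hred, hh'⟩ := ih (ord.toSyn e) (not_le.mp fun hle => hfe (hδ e heF hle)) h hh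
    fun e' he' hle => hlt e' he' (WithTop.coe_le_coe.mp hle)
  exact ⟨h', .head hstep hred, hh'⟩

theorem exists_mem_NF (hF : IsFerrers F) (hG : ∀ s ∈ corners F, IsResidueMonic ord s (G s))
    (hnil : IsNilpotent a) (f : MvPolynomial (Fin r) R) :
    (NF ord a (G '' corners F) f).Nonempty := by
  have hpos : 0 < nilpotencyClass a := pos_nilpotencyClass_iff.mpr hnil
  have hred : ∀ v, ∃ h, LReduces ord a (G '' corners F) f h ∧ ∀ e ∉ F, a ^ v ∣ h.coeff e := by
    intro v
    induction v with
    | zero => exact ⟨f, .refl, by simp⟩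
    | succ v ih =>
      obtain ⟨h, hfh, hh⟩ := ih
      obtain ⟨h', hhh', hh'⟩ := exists_lReduces_pow_succ_dvd ha hG hpos h hh
      exact ⟨h', hfh.trans hhh', hh'⟩
  obtain ⟨h, hfh, hh⟩ := hred (nilpotencyClass a)
  refine ⟨h, (isNormal_iff_support_subset ha hF hG hpos).mpr fun e he => ?_, hfh⟩
  by_contra hn
  refine MvPolynomial.mem_support_iff.mp he (zero_dvd_iff.mp ?_)
  exact pow_nilpotencyClass hnil ▸ hh e hn

theorem LReduces.C_pow_dvd_and_sub_mem (hG : ∀ s ∈ corners F, IsResidueMonic ord s (G s))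
    (hpos : 0 < nilpotencyClass a) {J : Ideal (MvPolynomial (Fin r) R)} {v : ℕ}
    (hJ : ∀ s ∈ corners F, MvPolynomial.C (a ^ v) * G s ∈ J)
    (hred : LReduces ord a (G '' corners F) f h) (hf : MvPolynomial.C (a ^ v) ∣ f) :
    MvPolynomial.C (a ^ v) ∣ h ∧ f - h ∈ J := by
  induction hred with
  | refl => exact ⟨hf, by simp⟩
  | @tail h₁ h₂ _ hstep ih =>
    obtain ⟨_, ⟨s, hs, rfl⟩, hstep⟩ := hstep
    obtain ⟨i, c, hc, -, rfl⟩ := ((hG s hs).lStep_iff ha hpos).mp (by simpa using hstep)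
    obtain ⟨d, hd⟩ := (MvPolynomial.C_dvd_iff_dvd_coeff _ _).mp ih.1 (i + s)
    have hterm : MvPolynomial.monomial i c * (MvPolynomial.C (a ^ 0) * G s) =
        MvPolynomial.monomial i d * (MvPolynomial.C (a ^ v) * G s) := by
      rw [pow_zero, mul_one] at hc
      rw [hc, hd, ← MvPolynomial.C_mul_monomial, pow_zero, map_one]
      ring
    rw [hterm]
    refine ⟨dvd_sub ih.1 (dvd_mul_of_dvd_right (dvd_mul_right _ _) _), ?_⟩
    rw [sub_sub_eq_add_sub, add_sub_right_comm]
    exact J.add_mem ih.2 (J.mul_mem_left _ (hJ s hs))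

end NormalForm

/-! ### Residue ideals -/

theorem eq_top_of_forall_exists_sub_smul_mem {R M : Type*} [CommRing R] [AddCommGroup M]
    [Module R M] {a : R} (hnil : IsNilpotent a) {N : Submodule R M}
    (hN : ∀ m, ∃ m', m - a • m' ∈ N) : N = ⊤ := by
  have hpow : ∀ k m, ∃ m', m - a ^ k • m' ∈ N := by
    intro k
    induction k with
    | zero => exact fun m => ⟨m, by simp⟩
    | succ k ih =>
      intro m
      obtain ⟨m', hm'⟩ := ih m
      obtain ⟨m'', hm''⟩ := hN m'
      refine ⟨m'', ?_⟩
      have hsum := N.add_mem hm' (N.smul_mem (a ^ k) hm'')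
      rwa [smul_sub, sub_add_sub_cancel, smul_smul, ← pow_succ] at hsum
  obtain ⟨k, hk⟩ := hnil
  refine (Submodule.eq_top_iff').mpr fun m => ?_
  obtain ⟨m', hm'⟩ := hpow k m
  rwa [hk, zero_smul, sub_zero] at hm'

section ResidueIdeal

variable {R : Type*} [CommRing R] [IsLocalRing R] {σ : Type*}

/-- The image over the residue field of the ideal of all `g` with `a ^ v * g ∈ J`. -/
def residueIdeal (a : R) (J : Ideal (MvPolynomial σ R)) (v : ℕ) :
    Ideal (MvPolynomial σ (IsLocalRing.ResidueField R)) :=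
  (J.colon {MvPolynomial.C (a ^ v)}).map (MvPolynomial.map (IsLocalRing.residue R))

variable {a : R} {J : Ideal (MvPolynomial σ R)}

theorem map_residue_surjective :
    Function.Surjective (MvPolynomial.map (σ := σ) (IsLocalRing.residue R)) :=
  MvPolynomial.map_surjective _ IsLocalRing.residue_surjective

theorem mem_residueIdeal {v : ℕ} {p : MvPolynomial σ (IsLocalRing.ResidueField R)} :
    p ∈ residueIdeal a J v ↔
      ∃ g, MvPolynomial.C (a ^ v) * g ∈ J ∧ MvPolynomial.map (IsLocalRing.residue R) g = p := by
  rw [residueIdeal, Ideal.mem_map_iff_of_surjective _ map_residue_surjective]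
  simp only [Submodule.mem_colon_singleton, smul_eq_mul, mul_comm]

variable (a J) in
theorem residueIdeal_mono : Monotone (residueIdeal a J) := by
  refine fun v w hvw => Ideal.map_mono fun g hg => ?_
  rw [Submodule.mem_colon_singleton, smul_eq_mul] at hg ⊢
  rw [← Nat.add_sub_cancel' hvw, pow_add, map_mul, ← mul_assoc]
  exact J.mul_mem_right _ hg

theorem exists_map_residue_eq (p : MvPolynomial σ (IsLocalRing.ResidueField R)) :
    ∃ f : MvPolynomial σ R, MvPolynomial.map (IsLocalRing.residue R) f = p ∧
      ∀ e ∈ f.support, e ∈ p.support ∧ IsUnit (f.coeff e) := by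
  classical
  obtain ⟨lift, hlift⟩ := (IsLocalRing.residue_surjective (R := R)).hasRightInverse
  let f : MvPolynomial σ R := ∑ e ∈ p.support, MvPolynomial.monomial e (lift (p.coeff e))
  have hf : MvPolynomial.map (IsLocalRing.residue R) f = p := by
    simp only [f, map_sum, MvPolynomial.map_monomial, hlift _]
    exact p.support_sum_monomial_coeff
  have hsupp : ∀ e ∈ f.support, e ∈ p.support := fun e he => by
    obtain ⟨e', he', hmem⟩ := Finset.mem_biUnion.mp (MvPolynomial.support_sum he)
    rwa [Finset.mem_singleton.mp (MvPolynomial.support_monomial_subset hmem)]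
  refine ⟨f, hf, fun e he => ⟨hsupp e he, ?_⟩⟩
  rw [← IsLocalRing.residue_ne_zero_iff_isUnit, ← MvPolynomial.coeff_map, hf]
  exact MvPolynomial.mem_support_iff.mp (hsupp e he)

variable (ha : IsLocalRing.maximalIdeal R = Ideal.span {a})
include ha

theorem exists_unit_remainder (ord : MonomialOrder σ) (J : Ideal (MvPolynomial σ R)) (v : ℕ)
    (g : MvPolynomial σ R) :
    ∃ i p, MvPolynomial.C (a ^ v) * i ∈ J ∧
      (∀ e ∈ p.support, IsStandard ord (residueIdeal a J v) e ∧ IsUnit (p.coeff e)) ∧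
      MvPolynomial.C a ∣ g - i - p := by
  obtain ⟨ρ, hρ, hstd⟩ := exists_sub_mem_isStandard ord (residueIdeal a J v)
    (MvPolynomial.map (IsLocalRing.residue R) g)
  obtain ⟨i, hi, hie⟩ := mem_residueIdeal.mp hρ
  obtain ⟨p, rfl, hp⟩ := exists_map_residue_eq ρ
  refine ⟨i, p, hi, fun e he => ⟨hstd e (hp e he).1, (hp e he).2⟩, ?_⟩
  rw [← map_residue_eq_zero_iff ha, map_sub, map_sub, hie, sub_sub_cancel, sub_self]

theorem C_pow_succ_dvd_of_isStandard {ord : MonomialOrder σ} {v : ℕ} (hv : v < nilpotencyClass a)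
    {f : MvPolynomial σ R} (hf : f ∈ J) (hdvd : MvPolynomial.C (a ^ v) ∣ f)
    (hstd : ∀ e ∈ f.support, IsStandard ord (residueIdeal a J v) e) :
    MvPolynomial.C (a ^ (v + 1)) ∣ f := by
  obtain ⟨g, rfl⟩ := hdvd
  rw [pow_succ, map_mul]
  refine mul_dvd_mul_left _ ((map_residue_eq_zero_iff ha).mp ?_)
  refine eq_zero_of_isStandard (mem_residueIdeal.mpr ⟨g, hf, rfl⟩) fun e he => hstd e ?_
  rw [MvPolynomial.mem_support_iff, MvPolynomial.coeff_map] at he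
  rw [MvPolynomial.mem_support_iff, MvPolynomial.coeff_C_mul]
  exact fun h0 => he ((residue_eq_zero_iff_dvd ha).mpr (dvd_of_pow_mul_eq_zero ha hv h0))

theorem exists_support_subset_C_pow_mul_sub_mem {ord : MonomialOrder σ} (hnil : IsNilpotent a)
    {v : ℕ} {F : Finset (σ →₀ ℕ)} (hF : ∀ e, e ∈ F ↔ IsStandard ord (residueIdeal a J v) e)
    (g : MvPolynomial σ R) : ∃ p, p.support ⊆ F ∧ MvPolynomial.C (a ^ v) * (g - p) ∈ J := by
  have htop : (J.colon {MvPolynomial.C (a ^ v)}).restrictScalars R ⊔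
      MvPolynomial.restrictSupport R (F : Set (σ →₀ ℕ)) = ⊤ := by
    refine eq_top_of_forall_exists_sub_smul_mem hnil fun g => ?_
    obtain ⟨i, p, hi, hp, h, hh⟩ := exists_unit_remainder ha ord J v g
    refine ⟨h, ?_⟩
    rw [MvPolynomial.smul_eq_C_mul, ← hh, sub_sub, sub_sub_cancel]
    exact Submodule.add_mem_sup (Submodule.mem_colon_singleton.mpr (by rwa [smul_eq_mul, mul_comm]))
      fun e he => (hF e).mpr (hp e he).1
  obtain ⟨i, hi, p, hp, rfl⟩ := Submodule.mem_sup.mp (htop.ge (Submodule.mem_top (x := g)))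
  refine ⟨p, hp, ?_⟩
  rw [add_sub_cancel_right, mul_comm]
  exact Submodule.mem_colon_singleton.mp hi

theorem comap_residueIdeal (v : ℕ) :
    (residueIdeal a J v).comap (MvPolynomial.map (IsLocalRing.residue R)) =
      J.colon {MvPolynomial.C (a ^ v)} ⊔ Ideal.span {MvPolynomial.C a} := by
  rw [residueIdeal, Ideal.comap_map_of_surjective _ map_residue_surjective]
  congr 1
  ext g
  rw [Ideal.mem_comap, Ideal.mem_bot, map_residue_eq_zero_iff ha, Ideal.mem_span_singleton]

theorem length_quotient_eq_sum_card {ord : MonomialOrder σ} (hnil : IsNilpotent a)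
    {D : ℕ → Finset (σ →₀ ℕ)} (hD : ∀ v e, e ∈ D v ↔ IsStandard ord (residueIdeal a J v) e) :
    Module.length R (MvPolynomial σ R ⧸ J) =
      ∑ v ∈ Finset.range (nilpotencyClass a), ((D v).card : ℕ∞) := by
  have hmem : MvPolynomial.C a ^ nilpotencyClass a ∈ J := by
    rw [← map_pow, pow_nilpotencyClass hnil, map_zero]
    exact J.zero_mem
  rw [length_quotient_eq_sum_colon J (MvPolynomial.C a) hmem]
  refine Finset.sum_congr rfl fun v _ => ?_
  rw [← map_pow, ← comap_residueIdeal ha, ← length_quotient_eq_card (hD v),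
    ← Module.length_eq_of_surjective (S := R) IsLocalRing.residue_surjective]
  exact length_quotient_comap
    (f := MvPolynomial.mapAlgHom (Algebra.ofId R (IsLocalRing.ResidueField R)))
    map_residue_surjective (residueIdeal a J v)

end ResidueIdeal

section KrullFamily

variable {R : Type*} [CommRing R] {r : ℕ}

/-- The system `{G s | s ∈ 𝒦F}`, which is finite by Dickson's lemma. -/
def cornerSystem (F : Finset (Fin r →₀ ℕ)) (G : (Fin r →₀ ℕ) → MvPolynomial (Fin r) R) :
    Finset (MvPolynomial (Fin r) R) :=
  ((finite_corners F).image G).toFinset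

theorem coe_cornerSystem {F : Finset (Fin r →₀ ℕ)} {G : (Fin r →₀ ℕ) → MvPolynomial (Fin r) R} :
    (cornerSystem F G : Set (MvPolynomial (Fin r) R)) = G '' corners F :=
  Set.Finite.coe_toFinset _

variable [IsLocalRing R]

/-- The polynomials `G s`, `s ∈ 𝒦F`, that make up one Krull system of a canonical generating
system of `J`: `F` consists of the standard exponents of the residue ideal of `J` at level `v`, and
`G s` is an `F`-monic polynomial such that `a ^ v * G s ∈ J`. -/
structure IsKrullFamily (ord : MonomialOrder (Fin r)) (a : R) (J : Ideal (MvPolynomial (Fin r) R))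
    (v : ℕ) (F : Finset (Fin r →₀ ℕ)) (G : (Fin r →₀ ℕ) → MvPolynomial (Fin r) R) : Prop where
  mem_iff : ∀ e, e ∈ F ↔ IsStandard ord (residueIdeal a J v) e
  ferrersMonic : ∀ s ∈ corners F, IsFerrersMonic F s (G s)
  mem : ∀ s ∈ corners F, MvPolynomial.C (a ^ v) * G s ∈ J

variable {ord : MonomialOrder (Fin r)} {a : R} {J : Ideal (MvPolynomial (Fin r) R)} {v : ℕ}
  {F : Finset (Fin r →₀ ℕ)} {G : (Fin r →₀ ℕ) → MvPolynomial (Fin r) R}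

theorem exists_isKrullFamily (ha : IsLocalRing.maximalIdeal R = Ideal.span {a})
    (hnil : IsNilpotent a) (hF : ∀ e, e ∈ F ↔ IsStandard ord (residueIdeal a J v) e) :
    ∃ G, IsKrullFamily ord a J v F G := by
  choose p hp hpJ using fun s : Fin r →₀ ℕ =>
    exists_support_subset_C_pow_mul_sub_mem ha hnil hF (MvPolynomial.monomial s 1)
  exact ⟨fun s => MvPolynomial.monomial s 1 - p s, hF,
    fun s hs => ⟨hs, by rw [sub_sub_cancel]; exact hp s⟩, fun s _ => hpJ s⟩

namespace IsKrullFamily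

theorem isFerrers (h : IsKrullFamily ord a J v F G) : IsFerrers F :=
  fun _ _ hle he => (h.mem_iff _).mpr (((h.mem_iff _).mp he).of_le hle)

theorem coeff_eq_one (h : IsKrullFamily ord a J v F G) {s : Fin r →₀ ℕ} (hs : s ∈ corners F) :
    (G s).coeff s = 1 := by
  classical
  have h0 := MvPolynomial.notMem_support_iff.mp fun he => hs.1 ((h.ferrersMonic s hs).2 he)
  rwa [MvPolynomial.coeff_sub, MvPolynomial.coeff_monomial, if_pos rfl, sub_eq_zero, eq_comm] at h0

theorem mem_support_map (h : IsKrullFamily ord a J v F G) {s e : Fin r →₀ ℕ}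
    (hs : s ∈ corners F)
    (he : e ∈ (MvPolynomial.map (IsLocalRing.residue R) (G s)).support) : e = s ∨ e ∈ F := by
  classical
  have hGe := MvPolynomial.mem_support_iff.mp (MvPolynomial.support_map_subset _ _ he)
  refine or_iff_not_imp_left.mpr fun hne => (h.ferrersMonic s hs).2 ?_
  rwa [MvPolynomial.mem_support_iff, MvPolynomial.coeff_sub, MvPolynomial.coeff_monomial,
    if_neg (Ne.symm hne), zero_sub, neg_ne_zero]

theorem isResidueMonic (h : IsKrullFamily ord a J v F G) {s : Fin r →₀ ℕ} (hs : s ∈ corners F) :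
    IsResidueMonic ord s (G s) := by
  refine ⟨h.coeff_eq_one hs, ?_⟩
  have hne : MvPolynomial.map (IsLocalRing.residue R) (G s) ≠ 0 := fun h0 => by
    simpa [MvPolynomial.coeff_map, h.coeff_eq_one hs] using congrArg (MvPolynomial.coeff s) h0
  refine (h.mem_support_map hs (ord.degree_mem_support hne)).resolve_right fun hF => ?_
  exact (h.mem_iff _).mp hF _ (mem_residueIdeal.mpr ⟨_, h.mem s hs, rfl⟩) hne rfl

theorem leadingCoeff_map (h : IsKrullFamily ord a J v F G) {s : Fin r →₀ ℕ}
    (hs : s ∈ corners F) :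
    ord.leadingCoeff (MvPolynomial.map (IsLocalRing.residue R) (G s)) = 1 := by
  rw [MonomialOrder.leadingCoeff, (h.isResidueMonic hs).degree_map, MvPolynomial.coeff_map,
    h.coeff_eq_one hs, map_one]

theorem exists_degree_map_le (h : IsKrullFamily ord a J v F G) {e : Fin r →₀ ℕ}
    (he : ¬ IsStandard ord (residueIdeal a J v) e) :
    ∃ g ∈ MvPolynomial.map (IsLocalRing.residue R) '' (G '' corners F), ord.degree g ≤ e := by
  obtain ⟨s, hs, hse⟩ := exists_corner_le (mt (h.mem_iff e).mp he)
  exact ⟨_, ⟨G s, ⟨s, hs, rfl⟩, rfl⟩, by rwa [(h.isResidueMonic hs).degree_map]⟩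

theorem span_map_residue (h : IsKrullFamily ord a J v F G) :
    Ideal.span (MvPolynomial.map (IsLocalRing.residue R) '' (G '' corners F)) =
      residueIdeal a J v := by
  refine span_eq_of_exists_degree_le (ord := ord) ?_ ?_ fun e => h.exists_degree_map_le
  · rintro _ ⟨_, ⟨s, hs, rfl⟩, rfl⟩
    exact mem_residueIdeal.mpr ⟨_, h.mem s hs, rfl⟩
  · rintro ⟨_, ⟨s, hs, rfl⟩, h0⟩
    simpa [h0] using h.leadingCoeff_map hs

theorem isReducedGroebnerBasis (h : IsKrullFamily ord a J v F G) :
    IsReducedGroebnerBasis ord (residueIdeal a J v)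
      (MvPolynomial.map (IsLocalRing.residue R) '' (G '' corners F)) where
  subset := h.span_map_residue ▸ Ideal.subset_span
  exists_degree_le f hf hf0 := h.exists_degree_map_le fun hstd => hstd f hf hf0 rfl
  monic := by
    rintro _ ⟨_, ⟨s, hs, rfl⟩, rfl⟩
    exact h.leadingCoeff_map hs
  reduced := by
    rintro _ ⟨_, ⟨s, hs, rfl⟩, rfl⟩ _ ⟨_, ⟨s', hs', rfl⟩, rfl⟩ hne e he hle
    rw [(h.isResidueMonic hs').degree_map] at hle
    rcases h.mem_support_map hs he with rfl | heF
    · exact hne (by rw [le_antisymm hle (hs.2 hs'.1 hle)])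
    · exact notMem_of_corner_le h.isFerrers hs' hle heF

theorem isKrullSystem (h : IsKrullFamily ord a J v F G) :
    IsKrullSystem ord F (cornerSystem F G) where
  characteristic := ⟨G, h.ferrersMonic, coe_cornerSystem⟩
  injOn := by
    rw [coe_cornerSystem]
    rintro _ ⟨s, hs, rfl⟩ _ ⟨s', hs', rfl⟩ heq
    have hdeg := congrArg ord.degree heq
    rw [(h.isResidueMonic hs).degree_map, (h.isResidueMonic hs').degree_map] at hdeg
    rw [hdeg]
  groebner := by
    rw [coe_cornerSystem, h.span_map_residue]
    exact h.isReducedGroebnerBasis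

end IsKrullFamily

end KrullFamily

/-! ### Jump sequences -/

section JumpSequence

/-- The points `u = b 0 < ⋯ < b x` at which a sequence `D`, considered on the interval `[u, t)`,
changes its value, followed by the endpoint `b (x + 1) = t`. -/
structure IsJumpSequence {α : Type*} (D : ℕ → α) (u t x : ℕ) (b : ℕ → ℕ) : Prop where
  zero : b 0 = u
  lt_succ : ∀ m ≤ x, b m < b (m + 1)
  last : b (x + 1) = t
  eq_of_lt : ∀ m ≤ x, ∀ v, b m ≤ v → v < b (m + 1) → D v = D (b m)
  ne : ∀ m < x, D (b (m + 1)) ≠ D (b m)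

variable {α : Type*} {D : ℕ → α} {t x : ℕ} {b : ℕ → ℕ}

theorem IsJumpSequence.cons {u w : ℕ} (h : IsJumpSequence D w t x b) (huw : u < w)
    (hD : ∀ v, u ≤ v → v < w → D v = D u) (hne : D w ≠ D u) :
    IsJumpSequence D u t (x + 1) (fun m => Nat.casesOn m u b) where
  zero := rfl
  lt_succ
    | 0, _ => show u < b 0 by rwa [h.zero]
    | m + 1, hm => h.lt_succ m (Nat.le_of_succ_le_succ hm)
  last := h.last
  eq_of_lt
    | 0, _ => show ∀ v, u ≤ v → v < b 0 → D v = D u by rwa [h.zero]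
    | m + 1, hm => h.eq_of_lt m (Nat.le_of_succ_le_succ hm)
  ne
    | 0, _ => show D (b 0) ≠ D u by rwa [h.zero]
    | m + 1, hm => h.ne m (Nat.lt_of_succ_lt_succ hm)

theorem exists_isJumpSequence (D : ℕ → α) {u : ℕ} (hut : u < t) :
    ∃ x b, IsJumpSequence D u t x b := by
  classical
  by_cases hjump : ∃ w, u < w ∧ w < t ∧ D w ≠ D u
  · obtain ⟨huw, hwt, hne⟩ := Nat.find_spec hjump
    obtain ⟨x, b, h⟩ := exists_isJumpSequence D hwt
    refine ⟨x + 1, _, h.cons huw (fun v huv hv => ?_) hne⟩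
    rcases huv.eq_or_lt with rfl | huv
    · rfl
    · exact not_not.mp fun hv' => Nat.find_min hjump hv ⟨huv, hv.trans hwt, hv'⟩
  · push Not at hjump
    refine ⟨0, fun m => Nat.casesOn m u fun _ => t, rfl, ?_, rfl, ?_, by simp⟩
    · intro m hm
      rwa [Nat.le_zero.mp hm]
    · intro m hm v huv hvt
      obtain rfl := Nat.le_zero.mp hm
      rcases Nat.eq_or_lt_of_le huv with rfl | huv
      · rfl
      · exact hjump v huv hvt
termination_by t - u

namespace IsJumpSequence

variable {u : ℕ}

theorem le_last (h : IsJumpSequence D u t x b) {m : ℕ} (hm : m ≤ x + 1) : b m ≤ t := by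
  induction hm using Nat.decreasingInduction with
  | self => exact h.last.le
  | of_succ m hm ih => exact (h.lt_succ m (Nat.lt_succ_iff.mp hm)).le.trans ih

theorem lt_last (h : IsJumpSequence D u t x b) {m : ℕ} (hm : m ≤ x) : b m < t :=
  (h.lt_succ m hm).trans_le (h.le_last (Nat.succ_le_succ hm))

theorem add_le (h : IsJumpSequence D u t x b) {m : ℕ} (hm : m ≤ x + 1) : u + m ≤ b m := by
  induction m with
  | zero => exact h.zero.ge
  | succ m ih => exact (ih (Nat.le_of_succ_le hm)).trans_lt (h.lt_succ m (Nat.le_of_lt_succ hm))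

theorem exists_le_lt (h : IsJumpSequence D u t x b) {v : ℕ} (huv : u ≤ v) (hvt : v < t) :
    ∃ m ≤ x, b m ≤ v ∧ v < b (m + 1) := by
  have hlast : ∃ m, v < b (m + 1) := ⟨x, h.last.symm ▸ hvt⟩
  refine ⟨Nat.find hlast, Nat.find_min' hlast (h.last.symm ▸ hvt), ?_, Nat.find_spec hlast⟩
  rcases hm : Nat.find hlast with _ | m
  · exact h.zero.trans_le huv
  · exact not_lt.mp (Nat.find_min hlast (hm ▸ Nat.lt_succ_self m))

theorem sum_range_succ (h : IsJumpSequence D u t x b) (f : α → ℕ) {m : ℕ} (hm : m ≤ x) :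
    ∑ v ∈ Finset.range (b (m + 1)), f (D v) =
      ∑ v ∈ Finset.range (b m), f (D v) + (b (m + 1) - b m) * f (D (b m)) := by
  have hconst : ∀ v ∈ Finset.Ico (b m) (b (m + 1)), f (D v) = f (D (b m)) := fun v hv =>
    congrArg f (h.eq_of_lt m hm v (Finset.mem_Ico.mp hv).1 (Finset.mem_Ico.mp hv).2)
  rw [← Finset.sum_range_add_sum_Ico _ (h.lt_succ m hm).le, Finset.sum_congr rfl hconst,
    Finset.sum_const, Nat.card_Ico, smul_eq_mul]

theorem cardExponent_eq {r : ℕ} {D : ℕ → Finset (Fin r →₀ ℕ)} (h : IsJumpSequence D 0 t x b)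
    (hD : Antitone D) {n : ℕ} (hn : (D 0).card ≤ n) :
    cardExponent t n x b (fun m => D (b m)) = ∑ v ∈ Finset.range t, (n - (D v).card) := by
  have hpartial : ∀ k ≤ x + 1,
      ∑ m ∈ Finset.range k, (t - b m) * (prevCard n (fun m => D (b m)) m - (D (b m)).card) =
        ∑ v ∈ Finset.range (b k), (n - (D v).card) +
          (t - b k) * (n - prevCard n (fun m => D (b m)) k) := by
    intro k hk
    induction k with
    | zero => simp [h.zero, prevCard]
    | succ m ih =>
      have hmx := Nat.le_of_succ_le_succ hk
      have hle : (D (b m)).card ≤ prevCard n (fun m => D (b m)) m ∧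
          prevCard n (fun m => D (b m)) m ≤ n := by
        rcases m with _ | m
        · exact ⟨h.zero.symm ▸ hn, le_rfl⟩
        · exact ⟨Finset.card_le_card (hD (h.lt_succ m (Nat.le_of_succ_le hmx)).le),
            (Finset.card_le_card (hD (Nat.zero_le _))).trans hn⟩
      rw [Finset.sum_range_succ, ih (Nat.le_of_succ_le hk),
        h.sum_range_succ (fun F => n - F.card) hmx, add_assoc, add_assoc, ← mul_add, prevCard,
        ← add_mul, Nat.sub_add_sub_cancel hle.2 hle.1, add_comm (b (m + 1) - b m),
        Nat.sub_add_sub_cancel (h.le_last hk) (h.lt_succ m hmx).le]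
  rw [cardExponent, hpartial _ le_rfl, h.last, Nat.sub_self, zero_mul, add_zero]

end IsJumpSequence

end JumpSequence

/-! ### Canonical systems of polynomial ideals -/

theorem C_pow_mul_mem_of_mem_span {R σ : Type*} [CommRing R] {a : R}
    {J : Ideal (MvPolynomial σ R)} {B : Set (MvPolynomial σ R)} {v k : ℕ}
    (hB : ∀ g ∈ B, MvPolynomial.C (a ^ v) * g ∈ J) (hvk : v ≤ k) {g : MvPolynomial σ R}
    (hg : g ∈ Ideal.span B) : MvPolynomial.C (a ^ k) * g ∈ J := by
  have hle : Ideal.span B ≤ J.colon {MvPolynomial.C (a ^ v)} := Ideal.span_le.mpr fun g hg =>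
    Submodule.mem_colon_singleton.mpr (by rw [smul_eq_mul, mul_comm]; exact hB g hg)
  rw [← Nat.sub_add_cancel hvk, pow_add, map_mul, mul_assoc, mul_comm (MvPolynomial.C (a ^ v))]
  exact J.mul_mem_left _ (Submodule.mem_colon_singleton.mp (hle hg))

section NormalModulo

variable {R : Type*} [CommRing R] [IsLocalRing R] {σ : Type*}

/-- The coefficient of `p` at `e` is divisible by `a ^ v` only if it is zero or `e` is a standard
exponent of the residue ideal of `J` at level `v`. This says that `p` cannot be `L`-reduced mod any
canonical generating system of `J`. -/
def IsNormalModulo (ord : MonomialOrder σ) (a : R) (J : Ideal (MvPolynomial σ R))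
    (p : MvPolynomial σ R) : Prop :=
  ∀ v < nilpotencyClass a, ∀ e, p.coeff e ≠ 0 → a ^ v ∣ p.coeff e →
    IsStandard ord (residueIdeal a J v) e

variable {ord : MonomialOrder σ} {a : R} {J : Ideal (MvPolynomial σ R)}
  (ha : IsLocalRing.maximalIdeal R = Ideal.span {a})
include ha

theorem IsNormalModulo.C_pow_mul_add {k : ℕ} {p p' : MvPolynomial σ R}
    (hp' : IsNormalModulo ord a J p') (hdvd : MvPolynomial.C (a ^ (k + 1)) ∣ p')
    (hp : ∀ e ∈ p.support, IsStandard ord (residueIdeal a J k) e ∧ IsUnit (p.coeff e)) :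
    IsNormalModulo ord a J (MvPolynomial.C (a ^ k) * p + p') := by
  intro v hv e he hve
  rw [MvPolynomial.coeff_add, MvPolynomial.coeff_C_mul] at he hve
  by_cases hep : e ∈ p.support
  · obtain ⟨hstd, hunit⟩ := hp e hep
    refine hstd.anti (residueIdeal_mono a J (not_lt.mp fun hkv => ?_))
    have hpow : a ^ (k + 1) ∣ a ^ k * p.coeff e :=
      (dvd_add_left ((MvPolynomial.C_dvd_iff_dvd_coeff _ _).mp hdvd e)).mp
        ((pow_dvd_pow a hkv).trans hve)
    exact (not_isUnit_iff_dvd ha).mpr ((pow_succ_dvd_pow_mul_iff ha (hkv.trans hv)).mp hpow) hunit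
  · rw [MvPolynomial.notMem_support_iff.mp hep, mul_zero, zero_add] at he hve
    exact hp' v hv e he hve

theorem exists_sub_mem_isNormalModulo (hnil : IsNilpotent a) (ord : MonomialOrder σ)
    (J : Ideal (MvPolynomial σ R)) (f : MvPolynomial σ R) :
    ∃ p, f - p ∈ J ∧ IsNormalModulo ord a J p := by
  suffices key : ∀ k ≤ nilpotencyClass a, ∀ f : MvPolynomial σ R, MvPolynomial.C (a ^ k) ∣ f →
      ∃ p, MvPolynomial.C (a ^ k) ∣ p ∧ f - p ∈ J ∧ IsNormalModulo ord a J p by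
    obtain ⟨p, -, h⟩ := key 0 (Nat.zero_le _) f (by simp)
    exact ⟨p, h⟩
  intro k hk
  induction hk using Nat.decreasingInduction with
  | self =>
    intro f hf
    rw [pow_nilpotencyClass hnil, map_zero, zero_dvd_iff] at hf
    exact ⟨0, dvd_zero _, by simp [hf], fun _ _ e he => absurd (MvPolynomial.coeff_zero e) he⟩
  | of_succ k _ ih =>
    rintro _ ⟨g, rfl⟩
    obtain ⟨i, p, hi, hp, h, hh⟩ := exists_unit_remainder ha ord J k g
    obtain ⟨p', hdvd, hsub, hp'⟩ := ih _ (dvd_mul_right (MvPolynomial.C (a ^ (k + 1))) h)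
    refine ⟨MvPolynomial.C (a ^ k) * p + p', dvd_add (dvd_mul_right _ _)
      ((map_dvd _ (pow_dvd_pow a k.le_succ)).trans hdvd), ?_, hp'.C_pow_mul_add ha hdvd hp⟩
    have hsplit : MvPolynomial.C (a ^ k) * g - (MvPolynomial.C (a ^ k) * p + p') =
        MvPolynomial.C (a ^ k) * i + (MvPolynomial.C (a ^ (k + 1)) * h - p') := by
      rw [pow_succ, map_mul, mul_assoc, ← hh]
      ring
    rw [hsplit]
    exact J.add_mem hi hsub

end NormalModulo

section CanonicalSystem

variable {R : Type*} [CommRing R] [IsLocalRing R] {r : ℕ}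

/-- The data of a canonical generating system of an ideal `J` of the polynomial ring: `D v` is the
set of standard exponents at level `v`, the levels `b 0, …, b x` are those where `D` changes, and
`G m` consists of the polynomials of the `m`-th Krull system. -/
structure IsCanonicalSystem (ord : MonomialOrder (Fin r)) (a : R)
    (J : Ideal (MvPolynomial (Fin r) R)) (D : ℕ → Finset (Fin r →₀ ℕ)) (x : ℕ) (b : ℕ → ℕ)
    (G : ℕ → (Fin r →₀ ℕ) → MvPolynomial (Fin r) R) : Prop where
  mem_iff : ∀ v e, e ∈ D v ↔ IsStandard ord (residueIdeal a J v) e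
  isJumpSequence : IsJumpSequence D 0 (nilpotencyClass a) x b
  isKrullFamily : ∀ m, IsKrullFamily ord a J (b m) (D (b m)) (G m)

variable {ord : MonomialOrder (Fin r)} {a : R} {J : Ideal (MvPolynomial (Fin r) R)}
  {D : ℕ → Finset (Fin r →₀ ℕ)} {x : ℕ} {b : ℕ → ℕ}
  {G : ℕ → (Fin r →₀ ℕ) → MvPolynomial (Fin r) R}

theorem exists_isCanonicalSystem (ha : IsLocalRing.maximalIdeal R = Ideal.span {a})
    (hnil : IsNilpotent a) (hD : ∀ v e, e ∈ D v ↔ IsStandard ord (residueIdeal a J v) e) :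
    ∃ x b G, IsCanonicalSystem ord a J D x b G := by
  obtain ⟨x, b, hb⟩ := exists_isJumpSequence D (pos_nilpotencyClass_iff.mpr hnil)
  choose G hG using fun m => exists_isKrullFamily ha hnil (hD (b m))
  exact ⟨x, b, G, hD, hb, hG⟩

namespace IsCanonicalSystem

theorem antitone (h : IsCanonicalSystem ord a J D x b G) : Antitone D := fun v w hvw e he =>
  (h.mem_iff v e).mpr (((h.mem_iff w e).mp he).anti (residueIdeal_mono a J hvw))

theorem ssubset (h : IsCanonicalSystem ord a J D x b G) {m : ℕ} (hm : m < x) :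
    D (b (m + 1)) ⊂ D (b m) :=
  (h.antitone (h.isJumpSequence.lt_succ m hm.le).le).ssubset_of_ne (h.isJumpSequence.ne m hm)

theorem residueIdeal_eq (h : IsCanonicalSystem ord a J D x b G) {m v : ℕ} (hm : m ≤ x)
    (hle : b m ≤ v) (hlt : v < b (m + 1)) : residueIdeal a J (b m) = residueIdeal a J v :=
  eq_of_forall_isStandard (ord := ord) (residueIdeal_mono a J hle) fun e he => by
    rwa [← h.mem_iff, h.isJumpSequence.eq_of_lt m hm v hle hlt, h.mem_iff]

variable (ha : IsLocalRing.maximalIdeal R = Ideal.span {a})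
include ha

theorem C_pow_dvd_of_support_subset (h : IsCanonicalSystem ord a J D x b G) {m : ℕ} (hm : m ≤ x)
    {f : MvPolynomial (Fin r) R} (hf : f ∈ J) (hsupp : f.support ⊆ D (b m)) :
    MvPolynomial.C (a ^ b (m + 1)) ∣ f := by
  suffices key : ∀ v ≤ b (m + 1), MvPolynomial.C (a ^ v) ∣ f from key _ le_rfl
  intro v hv
  induction v with
  | zero => simp
  | succ v ih =>
    have hle : residueIdeal a J v ≤ residueIdeal a J (b m) :=
      (le_total v (b m)).elim (fun hvm => residueIdeal_mono a J hvm)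
        fun hmv => (h.residueIdeal_eq hm hmv hv).ge
    exact C_pow_succ_dvd_of_isStandard ha
      (lt_of_lt_of_le hv (h.isJumpSequence.le_last (Nat.succ_le_succ hm))) hf
      (ih (Nat.le_of_succ_le hv)) fun e he => ((h.mem_iff _ e).mp (hsupp he)).anti hle

theorem exists_C_pow_dvd_sub (h : IsCanonicalSystem ord a J D x b G)
    {S : Ideal (MvPolynomial (Fin r) R)}
    (hS : ∀ m ≤ x, ∀ s ∈ corners (D (b m)), MvPolynomial.C (a ^ b m) * G m s ∈ S)
    {k : ℕ} (hk : k < nilpotencyClass a) {f : MvPolynomial (Fin r) R} (hf : f ∈ J)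
    (hdvd : MvPolynomial.C (a ^ k) ∣ f) :
    ∃ f' ∈ J ⊓ S, MvPolynomial.C (a ^ (k + 1)) ∣ f - f' := by
  obtain ⟨g, rfl⟩ := hdvd
  obtain ⟨m, hm, hmk, hkm⟩ := h.isJumpSequence.exists_le_lt (Nat.zero_le k) hk
  have hg : MvPolynomial.map (IsLocalRing.residue R) g ∈ residueIdeal a J (b m) :=
    h.residueIdeal_eq hm hmk hkm ▸ mem_residueIdeal.mpr ⟨g, hf, rfl⟩
  rw [← (h.isKrullFamily m).span_map_residue, ← Ideal.map_span,
    Ideal.mem_map_iff_of_surjective _ map_residue_surjective] at hg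
  obtain ⟨g', hg', hmap⟩ := hg
  refine ⟨MvPolynomial.C (a ^ k) * g', C_pow_mul_mem_of_mem_span ?_ hmk hg', ?_⟩
  · rintro _ ⟨s, hs, rfl⟩
    exact ⟨(h.isKrullFamily m).mem s hs, hS m hm s hs⟩
  · rw [← mul_sub, pow_succ, map_mul]
    refine mul_dvd_mul_left _ ((map_residue_eq_zero_iff ha).mp ?_)
    rw [map_sub, hmap, sub_self]

theorem le_of_forall_corner_mem (h : IsCanonicalSystem ord a J D x b G) (hnil : IsNilpotent a)
    {S : Ideal (MvPolynomial (Fin r) R)}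
    (hS : ∀ m ≤ x, ∀ s ∈ corners (D (b m)), MvPolynomial.C (a ^ b m) * G m s ∈ S) : J ≤ S := by
  suffices key : ∀ k ≤ nilpotencyClass a, ∀ f ∈ J, MvPolynomial.C (a ^ k) ∣ f → f ∈ S from
    fun f hf => key 0 (Nat.zero_le _) f hf (by simp)
  intro k hk
  induction hk using Nat.decreasingInduction with
  | self =>
    intro f _ hdvd
    rw [pow_nilpotencyClass hnil, map_zero, zero_dvd_iff] at hdvd
    exact hdvd ▸ S.zero_mem
  | of_succ k hk ih =>
    intro f hf hdvd
    obtain ⟨f', ⟨hf'J, hf'S⟩, hdvd'⟩ := h.exists_C_pow_dvd_sub ha hS hk hf hdvd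
    exact (Submodule.sub_mem_iff_left S hf'S).mp (ih _ (J.sub_mem hf hf'J) hdvd')

section NFSequence

variable {f : MvPolynomial (Fin r) R} {p : ℕ → MvPolynomial (Fin r) R}

theorem exists_isNFSequence (h : IsCanonicalSystem ord a J D x b G) (hnil : IsNilpotent a)
    (f : MvPolynomial (Fin r) R) :
    ∃ p, IsNFSequence ord a x (fun m => cornerSystem (D (b m)) (G m)) f p := by
  choose N hN using fun m => exists_mem_NF ha (h.isKrullFamily m).isFerrers
    (fun _ hs => (h.isKrullFamily m).isResidueMonic hs) hnil
  exact ⟨fun m => Nat.rec f (fun m p => N m p) m, rfl,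
    fun m _ => by rw [coe_cornerSystem]; exact hN m _⟩

theorem support_subset_of_isNFSequence (h : IsCanonicalSystem ord a J D x b G)
    (hp : IsNFSequence ord a x (fun m => cornerSystem (D (b m)) (G m)) f p) {m : ℕ} (hm : m ≤ x) :
    (p (m + 1)).support ⊆ D (b m) := by
  have hnormal := (hp.2 m hm).1
  rw [coe_cornerSystem] at hnormal
  exact (isNormal_iff_support_subset ha (h.isKrullFamily m).isFerrers
    (fun _ hs => (h.isKrullFamily m).isResidueMonic hs)
    ((Nat.zero_le _).trans_lt (h.isJumpSequence.lt_last hm))).mp hnormal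

theorem sub_mem_of_isNFSequence (h : IsCanonicalSystem ord a J D x b G)
    (hp : IsNFSequence ord a x (fun m => cornerSystem (D (b m)) (G m)) f p) {m : ℕ} (hm : m ≤ x)
    (hdvd : MvPolynomial.C (a ^ b m) ∣ p m) : p m - p (m + 1) ∈ J := by
  have hred := (hp.2 m hm).2
  rw [coe_cornerSystem] at hred
  exact (hred.C_pow_dvd_and_sub_mem ha (fun _ hs => (h.isKrullFamily m).isResidueMonic hs)
    ((Nat.zero_le _).trans_lt (h.isJumpSequence.lt_last hm)) (h.isKrullFamily m).mem hdvd).2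

theorem mem_and_dvd_of_isNFSequence (h : IsCanonicalSystem ord a J D x b G)
    (hp : IsNFSequence ord a x (fun m => cornerSystem (D (b m)) (G m)) f p) (hf : f ∈ J) {m : ℕ}
    (hm : m ≤ x + 1) : p m ∈ J ∧ MvPolynomial.C (a ^ b m) ∣ p m := by
  induction m with
  | zero => exact ⟨hp.1.symm ▸ hf, by simp [h.isJumpSequence.zero]⟩
  | succ m ih =>
    obtain ⟨hmem, hdvd⟩ := ih (Nat.le_of_succ_le hm)
    have hmx := Nat.le_of_succ_le_succ hm
    have hmem' : p (m + 1) ∈ J :=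
      (Submodule.sub_mem_iff_right J hmem).mp (h.sub_mem_of_isNFSequence ha hp hmx hdvd)
    exact ⟨hmem', h.C_pow_dvd_of_support_subset ha hmx hmem'
      (h.support_subset_of_isNFSequence ha hp hmx)⟩

theorem mem_iff_of_isNFSequence (h : IsCanonicalSystem ord a J D x b G) (hnil : IsNilpotent a)
    (hp : IsNFSequence ord a x (fun m => cornerSystem (D (b m)) (G m)) f p) :
    f ∈ J ↔ (∀ m ≤ x, b m ≤ polyNorm a (p m)) ∧ p (x + 1) = 0 := by
  have hnorm {m : ℕ} (hm : m ≤ x) : b m ≤ polyNorm a (p m) ↔ MvPolynomial.C (a ^ b m) ∣ p m :=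
    le_polyNorm_iff (h.isJumpSequence.lt_last hm).le
  constructor
  · intro hf
    have hlast := (h.mem_and_dvd_of_isNFSequence ha hp hf le_rfl).2
    rw [h.isJumpSequence.last, pow_nilpotencyClass hnil, map_zero, zero_dvd_iff] at hlast
    exact ⟨fun m hm => (hnorm hm).mpr
      (h.mem_and_dvd_of_isNFSequence ha hp hf (Nat.le_succ_of_le hm)).2, hlast⟩
  · rintro ⟨hb, hlast⟩
    have htelescope : ∑ m ∈ Finset.range (x + 1), (p m - p (m + 1)) ∈ J :=
      J.sum_mem fun m hm => h.sub_mem_of_isNFSequence ha hp (Finset.mem_range_succ_iff.mp hm)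
        ((hnorm (Finset.mem_range_succ_iff.mp hm)).mp (hb m (Finset.mem_range_succ_iff.mp hm)))
    rwa [Finset.sum_range_sub', hlast, hp.1, sub_zero] at htelescope

end NFSequence

theorem isNormal_unionSystem (h : IsCanonicalSystem ord a J D x b G) {p : MvPolynomial (Fin r) R}
    (hp : IsNormalModulo ord a J p) :
    IsNormal ord a (unionSystem a x b fun m => cornerSystem (D (b m)) (G m)) p := by
  rintro ⟨h', _, ⟨m, hm, g, hg, rfl⟩, hstep⟩
  rw [← Finset.mem_coe, coe_cornerSystem] at hg
  obtain ⟨s, hs, rfl⟩ := hg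
  refine (isNormal_C_pow_mul_iff ha (h.isKrullFamily m).isFerrers
    (fun _ hs => (h.isKrullFamily m).isResidueMonic hs) (h.isJumpSequence.lt_last hm)).mpr
    (fun e he hdvd => ?_) ⟨h', _, ⟨s, hs, rfl⟩, hstep⟩
  exact (h.mem_iff _ e).mpr (hp _ (h.isJumpSequence.lt_last hm) e he hdvd)

end IsCanonicalSystem

end CanonicalSystem

/-! ### Canonical generating systems of ideals of the affine algebra -/

section Existence

variable {R : Type*} [CommRing R] {r : ℕ}

theorem coeff_aeval_X_natDegree (i : Fin r) (p : R[X]) :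
    (Polynomial.aeval (MvPolynomial.X i : MvPolynomial (Fin r) R) p).coeff
      (Finsupp.single i p.natDegree) = p.leadingCoeff := by
  simp [coeff_aeval_X, (Finsupp.single_injective i).eq_iff]

theorem degree_aeval_X (ord : MonomialOrder (Fin r)) (i : Fin r) (p : R[X]) :
    ord.degree (Polynomial.aeval (MvPolynomial.X i : MvPolynomial (Fin r) R) p) =
      Finsupp.single i p.natDegree := by
  rcases eq_or_ne p 0 with rfl | hp
  · simp
  refine ord.toSyn.injective (le_antisymm (ord.degree_le_iff.mpr fun e he => ?_)
    (ord.le_degree ?_))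
  · rw [MvPolynomial.mem_support_iff, coeff_aeval_X] at he
    obtain ⟨k, hk, hke⟩ := Finset.exists_ne_zero_of_sum_ne_zero he
    obtain ⟨rfl, -⟩ := ite_ne_right_iff.mp hke
    exact ord.toSyn_monotone (Finsupp.single_mono (Finset.mem_range_succ_iff.mp hk))
  · rw [MvPolynomial.mem_support_iff, coeff_aeval_X_natDegree]
    exact Polynomial.leadingCoeff_ne_zero.mpr hp

theorem definingIdeal_le_comap {T : Fin r → R[X]} (J : Ideal (AffineAlgebra T)) :
    definingIdeal T ≤ J.comap (toAlg T) :=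
  Ideal.mk_ker.symm.trans_le (Ideal.comap_mono bot_le)

variable [IsLocalRing R] {ord : MonomialOrder (Fin r)} {a : R} {T : Fin r → R[X]}

theorem mem_box_of_isStandard (hT : ∀ j, (T j).Monic) {J : Ideal (MvPolynomial (Fin r) R)}
    (hJ : definingIdeal T ≤ J) {v : ℕ} {e : Fin r →₀ ℕ}
    (he : IsStandard ord (residueIdeal a J v) e) : e ∈ box T := by
  refine mem_box.mpr fun j => not_le.mp fun hj => ?_
  have hmonic := (hT j).map (IsLocalRing.residue R)
  have hmem : Polynomial.aeval (MvPolynomial.X j) ((T j).map (IsLocalRing.residue R)) ∈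
      residueIdeal a J v :=
    mem_residueIdeal.mpr ⟨_, J.mul_mem_left _ (hJ (Ideal.subset_span ⟨j, rfl⟩)), by
      rw [Polynomial.map_aeval_eq_aeval_map (ψ := MvPolynomial.map (IsLocalRing.residue R))
        (φ := IsLocalRing.residue R) (by ext; simp [MvPolynomial.algebraMap_eq]),
        MvPolynomial.map_X]⟩
  refine he.of_le (Finsupp.single_le_iff.mpr hj) _ hmem (fun h0 => ?_)
    (by rw [degree_aeval_X, (hT j).natDegree_map])
  have hcoeff := coeff_aeval_X_natDegree j ((T j).map (IsLocalRing.residue R))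
  rw [h0, hmonic.leadingCoeff, MvPolynomial.coeff_zero] at hcoeff
  exact zero_ne_one hcoeff

theorem card_le_prod_natDegree (hT : ∀ j, (T j).Monic) {J : Ideal (MvPolynomial (Fin r) R)}
    (hJ : definingIdeal T ≤ J) {v : ℕ} {D : Finset (Fin r →₀ ℕ)}
    (hD : ∀ e ∈ D, IsStandard ord (residueIdeal a J v) e) : D.card ≤ ∏ j, (T j).natDegree :=
  card_box T ▸ Finset.card_le_card fun e he => mem_box_of_isStandard hT hJ (hD e he)

theorem length_ideal_eq (ha : IsLocalRing.maximalIdeal R = Ideal.span {a}) (hnil : IsNilpotent a)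
    (hT : ∀ j, (T j).Monic) (J : Ideal (AffineAlgebra T)) {D : ℕ → Finset (Fin r →₀ ℕ)}
    (hD : ∀ v e, e ∈ D v ↔ IsStandard ord (residueIdeal a (J.comap (toAlg T)) v) e) :
    Module.length R J =
      (∑ v ∈ Finset.range (nilpotencyClass a), (∏ j, (T j).natDegree - (D v).card) : ℕ) := by
  have hcard (v : ℕ) : (D v).card ≤ ∏ j, (T j).natDegree :=
    card_le_prod_natDegree hT (definingIdeal_le_comap J) fun e => (hD v e).mp
  have hadd : Module.length R (AffineAlgebra T) =
      Module.length R J + Module.length R (AffineAlgebra T ⧸ J) :=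
    Module.length_eq_add_of_exact (J.subtype.restrictScalars R) (J.mkQ.restrictScalars R)
      J.subtype_injective J.mkQ_surjective (LinearMap.exact_subtype_mkQ J)
  have hquot : Module.length R (AffineAlgebra T ⧸ J) =
      (∑ v ∈ Finset.range (nilpotencyClass a), (D v).card : ℕ) := by
    rw [Nat.cast_sum, ← length_quotient_eq_sum_card ha hnil hD]
    exact (length_quotient_comap (Ideal.Quotient.mkₐ_surjective R (definingIdeal T)) J).symm
  have hsum : (∏ j, (T j).natDegree) * nilpotencyClass a =
      ∑ v ∈ Finset.range (nilpotencyClass a), (∏ j, (T j).natDegree - (D v).card) +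
        ∑ v ∈ Finset.range (nilpotencyClass a), (D v).card := by
    rw [← Finset.sum_add_distrib, Finset.sum_congr rfl fun v _ => Nat.sub_add_cancel (hcard v),
      Finset.sum_const, Finset.card_range, smul_eq_mul, mul_comm]
  rw [hquot, length_affineAlgebra hT, length_eq_nilpotencyClass ha hnil, ← Nat.cast_mul, hsum,
    Nat.cast_add] at hadd
  exact ((ENat.add_left_injective_of_ne_top (ENat.natCast_ne_top _)) hadd).symm

namespace IsCanonicalSystem

variable {J : Ideal (AffineAlgebra T)} {D : ℕ → Finset (Fin r →₀ ℕ)} {x : ℕ} {b : ℕ → ℕ}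
  {G : ℕ → (Fin r →₀ ℕ) → MvPolynomial (Fin r) R}

theorem C_pow_mul_mem {J : Ideal (MvPolynomial (Fin r) R)} (h : IsCanonicalSystem ord a J D x b G)
    {m : ℕ} {g : MvPolynomial (Fin r) R} (hg : g ∈ cornerSystem (D (b m)) (G m)) :
    MvPolynomial.C (a ^ b m) * g ∈ J := by
  rw [← Finset.mem_coe, coe_cornerSystem] at hg
  obtain ⟨s, hs, rfl⟩ := hg
  exact (h.isKrullFamily m).mem s hs

variable (h : IsCanonicalSystem ord a (J.comap (toAlg T)) D x b G)
  (ha : IsLocalRing.maximalIdeal R = Ideal.span {a}) (hnil : IsNilpotent a)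
include h ha hnil

theorem span_unionSystem :
    Ideal.span (toAlg T '' unionSystem a x b fun m => cornerSystem (D (b m)) (G m)) = J := by
  refine le_antisymm (Ideal.span_le.mpr ?_) ?_
  · rintro _ ⟨_, ⟨m, -, g, hg, rfl⟩, rfl⟩
    exact h.C_pow_mul_mem hg
  · refine (Ideal.comap_le_comap_iff_of_surjective _ Ideal.Quotient.mk_surjective _ _).mp
      (h.le_of_forall_corner_mem ha hnil fun m hm s hs => ?_)
    refine Ideal.subset_span ⟨_, ⟨m, hm, G m s, ?_, rfl⟩, rfl⟩
    rw [← Finset.mem_coe, coe_cornerSystem]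
    exact ⟨s, hs, rfl⟩

variable (hT : ∀ j, (T j).Monic)
include hT

theorem length_eq : Module.length R J =
    cardExponent (nilpotencyClass a) (∏ j, (T j).natDegree) x b fun m => D (b m) := by
  have hcard : (D 0).card ≤ ∏ j, (T j).natDegree :=
    card_le_prod_natDegree hT (definingIdeal_le_comap J) fun e => (h.mem_iff 0 e).mp
  rw [length_ideal_eq ha hnil hT J h.mem_iff, h.isJumpSequence.cardExponent_eq h.antitone hcard]

theorem isCGS : IsCGS ord a T hT J x (fun m => D (b m)) b
    fun m => cornerSystem (D (b m)) (G m) where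
  ferrers m _ := (h.isKrullFamily m).isFerrers
  subset_box e he := mem_box.mp
    (mem_box_of_isStandard hT (definingIdeal_le_comap J) ((h.mem_iff _ e).mp he))
  chain _ hm := h.ssubset hm
  b_zero := h.isJumpSequence.zero
  b_lt := h.isJumpSequence.lt_succ
  b_last := h.isJumpSequence.last
  norm_ge f hf m hm hsupp :=
    (le_polyNorm_iff (h.isJumpSequence.le_last (Nat.succ_le_succ hm))).mpr
      (h.C_pow_dvd_of_support_subset ha hm (by rwa [Ideal.mem_comap, toAlg_rep]) hsupp)
  krull m _ := (h.isKrullFamily m).isKrullSystem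
  krull_mem m _ _ hg := h.C_pow_mul_mem hg
  generates := h.span_unionSystem ha hnil
  nf_exists f := h.exists_isNFSequence ha hnil _
  mem_iff f p hp := by
    rw [← h.mem_iff_of_isNFSequence ha hnil hp, Ideal.mem_comap, toAlg_rep]
  card_eq := natCard_eq_pow_of_length_eq (h.length_eq ha hnil hT)

theorem exists_isNormal_rep (f : AffineAlgebra T) :
    ∃ f', IsNormal ord a (unionSystem a x b fun m => cornerSystem (D (b m)) (G m))
      (rep T hT f') ∧ f - f' ∈ J := by
  obtain ⟨p, hp, hnormal⟩ :=
    exists_sub_mem_isNormalModulo ha hnil ord (J.comap (toAlg T)) (rep T hT f)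
  have hreduced : IsReducedPoly T p := fun e he => mem_box.mp
    (mem_box_of_isStandard hT (definingIdeal_le_comap J)
      (hnormal 0 (pos_nilpotencyClass_iff.mpr hnil) e (MvPolynomial.mem_support_iff.mp he)
        (by simp)))
  refine ⟨toAlg T p, by rw [rep_toAlg hT hreduced]; exact h.isNormal_unionSystem ha hnormal, ?_⟩
  rwa [Ideal.mem_comap, map_sub, toAlg_rep] at hp

end IsCanonicalSystem

theorem exists_isCGS (ha : IsLocalRing.maximalIdeal R = Ideal.span {a}) (hnil : IsNilpotent a)
    (hT : ∀ j, (T j).Monic) (ord : MonomialOrder (Fin r)) (J : Ideal (AffineAlgebra T)) :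
    ∃ (x : ℕ) (F : ℕ → Finset (Fin r →₀ ℕ)) (b : ℕ → ℕ)
      (χ : ℕ → Finset (MvPolynomial (Fin r) R)),
      x ≤ nilpotencyClass a - 1 ∧ IsCGS ord a T hT J x F b χ ∧
      Module.length R J = cardExponent (nilpotencyClass a) (∏ j, (T j).natDegree) x b F ∧
      ∀ f, ∃ f', IsNormal ord a (unionSystem a x b χ) (rep T hT f') ∧ f - f' ∈ J := by
  classical
  let D (v : ℕ) : Finset (Fin r →₀ ℕ) :=
    (box T).filter (IsStandard ord (residueIdeal a (J.comap (toAlg T)) v))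
  have hD (v : ℕ) (e : Fin r →₀ ℕ) :
      e ∈ D v ↔ IsStandard ord (residueIdeal a (J.comap (toAlg T)) v) e :=
    Finset.mem_filter.trans
      (and_iff_right_of_imp (mem_box_of_isStandard hT (definingIdeal_le_comap J)))
  obtain ⟨x, b, G, h⟩ := exists_isCanonicalSystem ha hnil hD
  have hx : x + 1 ≤ nilpotencyClass a := by
    simpa only [zero_add, h.isJumpSequence.last] using h.isJumpSequence.add_le le_rfl
  exact ⟨x, _, b, _, Nat.le_sub_one_of_lt hx, h.isCGS ha hnil hT, h.length_eq ha hnil hT,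
    h.exists_isNormal_rep ha hnil hT⟩

end Existence

/-! ### Codes and their projection ideals -/

section Codes

variable {A : Type*} [CommRing A] {l : ℕ}

theorem mem_projIdeal {C : Submodule A (Fin l → A)} {i : Fin l} {f : A} :
    f ∈ projIdeal C i ↔ ∃ c ∈ C, (∀ s < i, c s = 0) ∧ c i = f := by
  simp only [projIdeal, Submodule.mem_map, LinearMap.proj_apply, ← and_assoc]
  rfl

/-- The codewords of `C` whose first `d` components are zero. -/
def truncation (C : Submodule A (Fin l → A)) (d : Fin (l + 1)) : Submodule A (Fin l → A) :=
  C ⊓ ⨅ s : {s : Fin l // s.castSucc < d}, LinearMap.ker (LinearMap.proj s.1)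

theorem mem_truncation {C : Submodule A (Fin l → A)} {d : Fin (l + 1)} {c : Fin l → A} :
    c ∈ truncation C d ↔ c ∈ C ∧ ∀ s : Fin l, s.castSucc < d → c s = 0 := by
  simp [truncation]

variable (C : Submodule A (Fin l → A))

theorem truncation_zero : truncation C 0 = C := by
  ext c
  simp [mem_truncation]

theorem truncation_last : truncation C (Fin.last l) = ⊥ := by
  refine eq_bot_iff.mpr fun c hc => (Submodule.mem_bot A).mpr (funext fun s => ?_)
  exact (mem_truncation.mp hc).2 s s.castSucc_lt_last

theorem truncation_succ (i : Fin l) :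
    truncation C i.succ = truncation C i.castSucc ⊓ LinearMap.ker (LinearMap.proj i) := by
  ext c
  simp only [mem_truncation, Submodule.mem_inf, LinearMap.mem_ker, LinearMap.proj_apply,
    and_assoc, Fin.castSucc_lt_succ_iff, Fin.castSucc_lt_castSucc_iff, le_iff_lt_or_eq, or_imp,
    forall_and, forall_eq]

theorem map_proj_truncation (i : Fin l) :
    (truncation C i.castSucc).map (LinearMap.proj i) = projIdeal C i := by
  ext f
  simp only [Submodule.mem_map, mem_truncation, LinearMap.proj_apply, mem_projIdeal, and_assoc,
    Fin.castSucc_lt_castSucc_iff]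

variable {C}

theorem eq_of_projIdeal_le {S : Submodule A (Fin l → A)} (h : S ≤ C)
    (hproj : ∀ i, projIdeal C i ≤ projIdeal S i) : S = C := by
  suffices key : ∀ d, truncation C d ≤ S from le_antisymm h (truncation_zero C ▸ key 0)
  intro d
  induction d using Fin.reverseInduction with
  | last => exact (truncation_last C).trans_le bot_le
  | cast i ih =>
    intro c hc
    have hci : c i ∈ projIdeal S i :=
      hproj i (map_proj_truncation C i ▸ Submodule.mem_map_of_mem hc)
    rw [← map_proj_truncation] at hci
    obtain ⟨c', hc', hci'⟩ := hci
    have hc'C : c' ∈ truncation C i.castSucc := inf_le_inf_right _ h hc'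
    have hsub : c - c' ∈ truncation C i.succ := truncation_succ C i ▸
      ⟨sub_mem hc hc'C, LinearMap.sub_mem_ker_iff.mpr hci'.symm⟩
    exact (Submodule.sub_mem_iff_left S (mem_truncation.mp hc').1).mp (ih hsub)

theorem exists_projIdeal_ne_bot (hC : C ≠ ⊥) : ∃ i, projIdeal C i ≠ ⊥ := by
  by_contra! h
  exact hC (eq_of_projIdeal_le bot_le fun i => (h i).trans_le bot_le).symm

theorem eq_add_sum_of_castSucc_eq {M : Type*} [AddCommMonoid M] {n : ℕ} {f : Fin (n + 1) → M}
    {g : Fin n → M} (h : ∀ i, f i.castSucc = f i.succ + g i) :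
    f 0 = f (Fin.last n) + ∑ i, g i := by
  induction n with
  | zero => simp
  | succ n ih =>
    have htail : f (Fin.succ 0) = f (Fin.last (n + 1)) + ∑ i : Fin n, g i.succ :=
      ih (f := fun i => f i.succ) fun i => h i.succ
    rw [Fin.sum_univ_succ, add_left_comm, ← htail, add_comm (g 0)]
    exact h 0

variable (C) in
theorem length_eq_sum_length_projIdeal (R : Type*) [CommRing R] [Algebra R A] :
    Module.length R C = ∑ i, Module.length R (projIdeal C i) := by
  have hstep (i : Fin l) : Module.length R (truncation C i.castSucc) =
      Module.length R (truncation C i.succ) + Module.length R (projIdeal C i) := by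
    rw [length_eq_add_length_map (LinearMap.proj i), truncation_succ, map_proj_truncation]
  have hsum := eq_add_sum_of_castSucc_eq (f := fun d => Module.length R (truncation C d)) hstep
  rwa [truncation_zero, truncation_last,
    Module.length_eq_zero (M := (⊥ : Submodule A (Fin l → A))), zero_add] at hsum

theorem rowVector_eq_self {i : Fin l} {c : Fin l → A} (hc : ∀ s < i, c s = 0) :
    rowVector i (c i) c = c := by
  funext z
  unfold rowVector
  split_ifs with hlt heq
  · exact (hc z hlt).symm
  · rw [heq]
  · rfl

theorem exists_mem_forall_gt {Q : Fin l → A → Prop}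
    (hQ : ∀ i f, ∃ f', Q i f' ∧ f - f' ∈ projIdeal C i) {c : Fin l → A} (hc : c ∈ C)
    (i : Fin l) : ∃ c' ∈ C, (∀ z ≤ i, c' z = c z) ∧ ∀ z, i < z → Q z (c' z) := by
  suffices key : ∀ d : Fin (l + 1), ∃ c' ∈ C, (∀ z ≤ i, c' z = c z) ∧
      ∀ z, i < z → z.castSucc < d → Q z (c' z) by
    obtain ⟨c', hc', heq, hlt⟩ := key (Fin.last l)
    exact ⟨c', hc', heq, fun z hz => hlt z hz z.castSucc_lt_last⟩
  intro d
  induction d using Fin.induction with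
  | zero => exact ⟨c, hc, fun _ _ => rfl, fun z _ hz => absurd hz (Fin.not_lt_zero _)⟩
  | succ d ih =>
    obtain ⟨c', hc', heq, hlt⟩ := ih
    rcases le_or_gt d i with hdi | hid
    · exact ⟨c', hc', heq, fun z hiz hzd =>
        absurd (hiz.trans_le (Fin.castSucc_lt_succ_iff.mp hzd)) hdi.not_gt⟩
    obtain ⟨f', hf', hmem⟩ := hQ d (c' d)
    obtain ⟨w, hw, hw0, hwd⟩ := mem_projIdeal.mp hmem
    refine ⟨c' - w, sub_mem hc' hw, fun z hz => ?_, fun z hiz hzd => ?_⟩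
    · rw [Pi.sub_apply, hw0 z (hz.trans_lt hid), sub_zero, heq z hz]
    · rcases (Fin.castSucc_lt_succ_iff.mp hzd).lt_or_eq with hz | rfl
      · rw [Pi.sub_apply, hw0 z hz, sub_zero]
        exact hlt z hiz hz
      · rwa [Pi.sub_apply, hwd, sub_sub_cancel]

theorem exists_rowVector_mem {Q : Fin l → A → Prop}
    (hQ : ∀ i f, ∃ f', Q i f' ∧ f - f' ∈ projIdeal C i) {i : Fin l} {f : A}
    (hf : f ∈ projIdeal C i) : ∃ h, rowVector i f h ∈ C ∧ ∀ z, i < z → Q z (h z) := by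
  obtain ⟨c, hc, hc0, rfl⟩ := mem_projIdeal.mp hf
  obtain ⟨h, hh, heq, hgt⟩ := exists_mem_forall_gt hQ hc i
  have h0 (s : Fin l) (hs : s < i) : h s = 0 := (heq s hs.le).trans (hc0 s hs)
  exact ⟨h, by rwa [← heq i le_rfl, rowVector_eq_self h0], hgt⟩

theorem isGeneratorMatrix_rowVector {ι : Type*} {i : ι → Fin l} {p : ι → A} {h : ι → Fin l → A}
    (hmem : ∀ ρ, rowVector (i ρ) (p ρ) (h ρ) ∈ C)
    (hspan : ∀ s, projIdeal C s ≤ Ideal.span (p '' {ρ | i ρ = s})) :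
    IsGeneratorMatrix (Matrix.of fun ρ => rowVector (i ρ) (p ρ) (h ρ)) C := by
  refine eq_of_projIdeal_le (Submodule.span_le.mpr (Set.range_subset_iff.mpr hmem)) fun s =>
    (hspan s).trans (Ideal.span_le.mpr ?_)
  rintro _ ⟨ρ, rfl, rfl⟩
  exact mem_projIdeal.mpr ⟨_, Submodule.subset_span ⟨ρ, rfl⟩, fun z hz => if_pos hz,
    by simp [rowVector]⟩

theorem exists_strictMono_range_eq {α : Type*} [LinearOrder α] {S : Set α} (hS : S.Finite) :
    ∃ (k : ℕ) (i : Fin k → α), StrictMono i ∧ Set.range i = S :=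
  ⟨_, hS.toFinset.orderEmbOfFin rfl, (hS.toFinset.orderEmbOfFin rfl).strictMono, by
    rw [Finset.range_orderEmbOfFin, hS.coe_toFinset]⟩

end Codes

end ChainCode

end

theorem theorem1_general {R : Type*} [CommRing R] [IsLocalRing R]
    (a : R) (ha : IsLocalRing.maximalIdeal R = Ideal.span {a}) (hnil : IsNilpotent a)
    {r : ℕ} (T : Fin r → R[X]) (hT : ∀ j, (T j).Monic)
    (ord : MonomialOrder (Fin r))
    {l : ℕ} (C : Submodule (AffineAlgebra T) (Fin l → AffineAlgebra T)) (hC : C ≠ ⊥) :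
    ∃ (k : ℕ) (i : Fin k → Fin l) (x : Fin k → ℕ)
      (F : Fin k → ℕ → Finset (Fin r →₀ ℕ)) (b : Fin k → ℕ → ℕ)
      (χ : Fin k → ℕ → Finset (MvPolynomial (Fin r) R))
      (h : RowIndex x χ → Fin l → AffineAlgebra T),
      1 ≤ k ∧ k ≤ l ∧ StrictMono i ∧ (∀ j, x j ≤ nilpotencyClass a - 1) ∧
      (∀ s : Fin l, (∃ j, i j = s) ↔ projIdeal C s ≠ ⊥) ∧
      (∀ j, IsCGS ord a T hT (projIdeal C (i j)) (x j) (F j) (b j) (χ j)) ∧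
      (∀ j, Module.length R (projIdeal C (i j)) =
        cardExponent (nilpotencyClass a) (∏ j, (T j).natDegree) (x j) (b j) (F j)) ∧
      Module.length R C =
        (∑ j, cardExponent (nilpotencyClass a) (∏ j, (T j).natDegree) (x j) (b j) (F j) : ℕ) ∧
      (∀ (ρ : RowIndex x χ) (j' : Fin k), ρ.1 < j' →
        IsNormal ord a (unionSystem a (x j') (b j') (χ j')) (rep T hT (h ρ (i j')))) ∧
      IsGeneratorMatrix
        (Matrix.of fun ρ : RowIndex x χ =>
          rowVector (i ρ.1) (toAlg T (MvPolynomial.C (a ^ b ρ.1 ρ.2.1) * ρ.2.2.1)) (h ρ)) C := by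
  choose x F b χ hx hcgs hlen hnormal using fun s => exists_isCGS ha hnil hT ord (projIdeal C s)
  obtain ⟨k, i, hmono, hrange⟩ := exists_strictMono_range_eq {s | projIdeal C s ≠ ⊥}.toFinite
  have hi (s : Fin l) : (∃ j, i j = s) ↔ projIdeal C s ≠ ⊥ := Set.ext_iff.mp hrange s
  choose h hmem hrow using fun ρ : RowIndex (fun j => x (i j)) fun j => χ (i j) =>
    exists_rowVector_mem hnormal
      ((hcgs (i ρ.1)).krull_mem ρ.2.1 (Nat.le_of_lt_succ ρ.2.1.2) _ ρ.2.2.2)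
  refine ⟨k, i, fun j => x (i j), fun j => F (i j), fun j => b (i j), fun j => χ (i j), h, ?_, ?_,
    hmono, fun j => hx _, hi, fun j => hcgs _, fun j => hlen _, ?_,
    fun ρ j' hj => hrow ρ _ (hmono hj), isGeneratorMatrix_rowVector hmem fun s => ?_⟩
  · obtain ⟨s, hs⟩ := exists_projIdeal_ne_bot hC
    exact ((hi s).mpr hs).choose.pos
  · simpa using Fintype.card_le_of_injective i hmono.injective
  · rw [length_eq_sum_length_projIdeal C R, Nat.cast_sum]
    refine (Fintype.sum_of_injective i hmono.injective _ _ (fun s hs => ?_)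
      fun j => (hlen (i j)).symm).symm
    rw [not_not.mp (mt (hi s).mpr hs), Module.length_eq_zero]
  · by_cases hs : projIdeal C s = ⊥
    · exact hs.trans_le bot_le
    obtain ⟨j, rfl⟩ := (hi s).mpr hs
    refine (hcgs (i j)).generates.ge.trans (Ideal.span_mono ?_)
    rintro _ ⟨_, ⟨m, hm, g, hg, rfl⟩, rfl⟩
    exact ⟨⟨j, ⟨m, Nat.lt_succ_of_le hm⟩, g, hg⟩, rfl, rfl⟩

theorem theorem1 {R : Type*} [CommRing R] [Finite R] [IsLocalRing R]
    (a : R) (ha : IsLocalRing.maximalIdeal R = Ideal.span {a})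
    (t : ℕ) (ht : t = nilpotencyClass a)
    (q : ℕ) (hq : q = Nat.card (IsLocalRing.ResidueField R))
    {r : ℕ} (T : Fin r → R[X]) (hT : ∀ j, (T j).Monic)
    (n : ℕ) (hn : n = ∏ j, (T j).natDegree)
    (ord : MonomialOrder (Fin r))
    {l : ℕ} (C : Submodule (AffineAlgebra T) (Fin l → AffineAlgebra T)) (hC : C ≠ ⊥) :
    ∃ (k : ℕ) (i : Fin k → Fin l) (x : Fin k → ℕ)
      (F : Fin k → ℕ → Finset (Fin r →₀ ℕ)) (b : Fin k → ℕ → ℕ)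
      (χ : Fin k → ℕ → Finset (MvPolynomial (Fin r) R))
      (h : RowIndex x χ → Fin l → AffineAlgebra T),
      1 ≤ k ∧ k ≤ l ∧ StrictMono i ∧ (∀ j, x j ≤ t - 1) ∧
      (∀ s : Fin l, (∃ j, i j = s) ↔ projIdeal C s ≠ ⊥) ∧
      (∀ j, IsCGS ord a T hT (projIdeal C (i j)) (x j) (F j) (b j) (χ j)) ∧
      Nat.card C = q ^ ∑ j, cardExponent t n (x j) (b j) (F j) ∧
      (∀ (ρ : RowIndex x χ) (j' : Fin k), ρ.1 < j' →
        IsNormal ord a (unionSystem a (x j') (b j') (χ j')) (rep T hT (h ρ (i j')))) ∧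
      IsGeneratorMatrix
        (Matrix.of fun ρ : RowIndex x χ =>
          rowVector (i ρ.1) (toAlg T (MvPolynomial.C (a ^ b ρ.1 ρ.2.1) * ρ.2.2.1)) (h ρ)) C := by
  subst ht hq hn
  obtain ⟨k, i, x, F, b, χ, h, hk, hkl, hi, hx, hpos, hcgs, -, hlen, hnormal, hgen⟩ :=
    theorem1_general a ha (isNilpotent_of_isArtinianRing ha) T hT ord C hC
  exact ⟨k, i, x, F, b, χ, h, hk, hkl, hi, hx, hpos, hcgs, natCard_eq_pow_of_length_eq hlen,
    hnormal, hgen⟩
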